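/- **Theorem 3.1.** For odd integers $p,q,r$ let $P(p,q,r)$ be the pretzel knot with three vertical twisted tassels of $|p|,|q|,|r|$ crossings, placed side by side and joined cyclically at the top and at the bottom by arcs; handedness is fixed by the convention that, when the knot is oriented, the crossings in a tassel with a positive parameter are negative crossings, and those in a tassel with a negative parameter are positive crossings. Let $V$ be the Jones polynomial of oriented links, normalised by $V(\text{unknot})=1$ and satisfying $$t^{-1}V(L_+)-tV(L_-)+(t^{-1/2}-t^{1/2})V(L_0)=0 .$$ Then, for every integer $i>2$ and either orientation of the knot, $$V\bigl(P(-3,3,2i+1)\bigr)=t^{-2i-4}-t^{-2i-3}+t^{-2i-2}-2t^{-2i-1}+t^{-2i}-t^{-2i+1}+t^{-2i+2}+1 .$$ -/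

import Mathlib

open LaurentPolynomial

namespace KnotTheory

/-- The three elementary pieces of a link diagram in the plane, read from top to bottom.
`birth b` is a local maximum: two new neighbouring strands, the left one oriented downwards
if `b = true` and upwards if `b = false`, the right one oppositely.
`death` is a local minimum joining two neighbouring strands.
`cross c` is a crossing of two neighbouring strands; for `c = true` the strand running from
bottom left to top right (shape `/`) is the over-strand, for `c = false` the other one is. -/
inductive Piece : Type
  | birth (b : Bool) : Piece
  | death : Piece
  | cross (c : Bool) : Piece

/-- Number of strands entering a piece from above. -/
def Piece.src : Piece → ℕ
  | .birth _ => 0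
  | .death => 2
  | .cross _ => 2

/-- Number of strands leaving a piece below. -/
def Piece.tgt : Piece → ℕ
  | .birth _ => 2
  | .death => 0
  | .cross _ => 2

/-- A horizontal slice of a diagram: a piece with `pos` vertical strands to its left and any
number of vertical strands to its right. -/
structure Slice : Type where
  pos : ℕ
  piece : Piece

/-- `Closes w o`: starting from strands with orientations `o` (from left to right; `true` is
downwards), the slices `w`, read from top to bottom, fit together, respect the orientations,
and leave no strand open at the bottom. -/
def Closes : List Slice → List Bool → Prop
  | [], o => o = []
  | ⟨j, .birth b⟩ :: w, o => j ≤ o.length ∧ Closes w (o.take j ++ b :: (!b) :: o.drop j)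
  | ⟨j, .death⟩ :: w, o =>
      match o.drop j with
      | a :: b :: r => b = (!a) ∧ Closes w (o.take j ++ r)
      | _ => False
  | ⟨j, .cross _⟩ :: w, o =>
      match o.drop j with
      | a :: b :: r => Closes w (o.take j ++ b :: a :: r)
      | _ => False

/-- A diagram of a nonempty oriented link, cut into horizontal slices (every link diagram in
the plane has this form after a small planar isotopy). -/
structure Diagram : Type where
  word : List Slice
  nonempty : word ≠ []
  closes : Closes word []

/-- Sign of a crossing whose two strands have orientations `a` and `b` (at the top left and
at the top right): if the strands run parallel, it is positive when `/` is the over-strand. -/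
def crossingSign (c a b : Bool) : ℤ :=
  if c = (a == b) then 1 else -1

/-- Sum of the signs of the crossings of `w`, the orientations at the top being `o`. -/
def writhe : List Slice → List Bool → ℤ
  | [], _ => 0
  | ⟨j, .birth b⟩ :: w, o => writhe w (o.take j ++ b :: (!b) :: o.drop j)
  | ⟨j, .death⟩ :: w, o =>
      match o.drop j with
      | _ :: _ :: r => writhe w (o.take j ++ r)
      | _ => 0
  | ⟨j, .cross c⟩ :: w, o =>
      match o.drop j with
      | a :: b :: r => crossingSign c a b + writhe w (o.take j ++ b :: a :: r)
      | _ => 0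

/-- A partially drawn diagram without crossings, as seen from below: the number of closed
loops so far, and the open strands from left to right, labelled such that two of them have the
same label exactly when they are the ends of one arc. -/
structure State : Type where
  loops : ℕ
  labels : List ℕ

/-- A label that does not occur in the list. -/
def freshLabel (l : List ℕ) : ℕ := l.foldr max 0 + 1

/-- Add a local maximum with `j` strands to its left. -/
def State.birth (j : ℕ) (s : State) : State :=
  ⟨s.loops, s.labels.take j ++ freshLabel s.labels :: freshLabel s.labels :: s.labels.drop j⟩

/-- Add a local minimum with `j` strands to its left: it closes a loop if it joins the two
ends of one arc, and merges two arcs into one otherwise. -/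
def State.death (j : ℕ) (s : State) : State :=
  match s.labels.drop j with
  | a :: b :: r =>
      if a = b then ⟨s.loops + 1, s.labels.take j ++ r⟩
      else ⟨s.loops, (s.labels.take j ++ r).map fun x => if x = b then a else x⟩
  | _ => s

/-- A local minimum above a local maximum, with `j` strands to the left. -/
def State.hook (j : ℕ) (s : State) : State := (s.death j).birth j

/-- Laurent polynomials over `ℤ` in one variable, written `t ^ (1/4)`; the monomial `T n` is
`t ^ (n/4)`. The variable of the Kauffman bracket is `A = t ^ (-1/4)`, so `A ^ n` is: -/
noncomputable def powA (n : ℤ) : ℤ[T;T⁻¹] := T (-n)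

/-- The power `t ^ n`. -/
noncomputable def powt (n : ℤ) : ℤ[T;T⁻¹] := T (4 * n)

/-- The value `-A ^ 2 - A ^ (-2)` of a loop. -/
noncomputable def loopValue : ℤ[T;T⁻¹] := -powA 2 - powA (-2)

/-- State sum over the two smoothings of every crossing of `w`, where a final state with `n`
loops has the weight `g n`. In a crossing with over-strand `/` the smoothing into two vertical
strands has coefficient `A`, the one into a local minimum above a local maximum has `A⁻¹`;
for the other over-strand the coefficients are interchanged. -/
noncomputable def stateSum (g : ℕ → ℤ[T;T⁻¹]) : List Slice → State → ℤ[T;T⁻¹]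
  | [], s => g s.loops
  | ⟨j, .birth _⟩ :: w, s => stateSum g w (s.birth j)
  | ⟨j, .death⟩ :: w, s => stateSum g w (s.death j)
  | ⟨j, .cross c⟩ :: w, s =>
      powA (if c then 1 else -1) * stateSum g w s +
        powA (if c then -1 else 1) * stateSum g w (s.hook j)

/-- The Kauffman bracket, `∑ A ^ (a - b) * (-A ^ 2 - A ^ (-2)) ^ (loops - 1)`, normalised to be
`1` on a circle without crossings. -/
noncomputable def Diagram.bracket (D : Diagram) : ℤ[T;T⁻¹] :=
  stateSum (fun n => loopValue ^ (n - 1)) D.word ⟨0, []⟩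

/-- `(-A ^ 3) ^ (-n)` -/
noncomputable def writheFactor (n : ℤ) : ℤ[T;T⁻¹] := (n.negOnePow : ℤ) • powA (-3 * n)

/-- The Jones polynomial of a diagram, `(-A ^ 3) ^ (-writhe) * bracket`. -/
noncomputable def Diagram.jones (D : Diagram) : ℤ[T;T⁻¹] :=
  writheFactor (writhe D.word []) * D.bracket

/-- The local moves on oriented link diagrams: planar isotopy and the Reidemeister moves. -/
inductive LocalMove : List Slice → List Slice → Prop
  /-- pieces next to each other may change their heights -/
  | exchange (p q : Piece) (i k : ℕ) :
      LocalMove [⟨i, p⟩, ⟨i + p.tgt + k, q⟩] [⟨i + p.src + k, q⟩, ⟨i, p⟩]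
  /-- straightening of a strand -/
  | zigzag_right (j : ℕ) (b : Bool) : LocalMove [⟨j, .birth b⟩, ⟨j + 1, .death⟩] []
  | zigzag_left (j : ℕ) (b : Bool) : LocalMove [⟨j + 1, .birth b⟩, ⟨j, .death⟩] []
  /-- a strand passing over or under a maximum or a minimum -/
  | slide_birth (j : ℕ) (b c : Bool) :
      LocalMove [⟨j, .birth b⟩, ⟨j + 1, .cross c⟩] [⟨j + 1, .birth b⟩, ⟨j, .cross (!c)⟩]
  | slide_death (j : ℕ) (c : Bool) :
      LocalMove [⟨j + 1, .cross c⟩, ⟨j, .death⟩] [⟨j, .cross (!c)⟩, ⟨j + 1, .death⟩]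
  /-- first Reidemeister move, at a maximum and at a minimum -/
  | reidemeister_one_birth (j : ℕ) (b c : Bool) :
      LocalMove [⟨j, .birth b⟩, ⟨j, .cross c⟩] [⟨j, .birth (!b)⟩]
  | reidemeister_one_death (j : ℕ) (c : Bool) :
      LocalMove [⟨j, .cross c⟩, ⟨j, .death⟩] [⟨j, .death⟩]
  /-- second Reidemeister move -/
  | reidemeister_two (j : ℕ) (c : Bool) : LocalMove [⟨j, .cross c⟩, ⟨j, .cross (!c)⟩] []
  /-- third Reidemeister move -/
  | reidemeister_three (j : ℕ) (c : Bool) :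
      LocalMove [⟨j, .cross c⟩, ⟨j + 1, .cross c⟩, ⟨j, .cross c⟩]
        [⟨j + 1, .cross c⟩, ⟨j, .cross c⟩, ⟨j + 1, .cross c⟩]

/-- Two diagrams differ by one local move. -/
def Move (D E : Diagram) : Prop :=
  ∃ u r r' v, LocalMove r r' ∧ D.word = u ++ r ++ v ∧ E.word = u ++ r' ++ v


/-! ### Invariance of the Jones polynomial under the moves -/

theorem lt_freshLabel {l : List ℕ} {x : ℕ} (h : x ∈ l) : x < freshLabel l := by
  induction l with
  | nil => simp at h
  | cons y l ih =>
    simp only [freshLabel, List.foldr_cons, List.mem_cons] at *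
    rcases h with rfl | h
    · omega
    · have := ih h
      omega

/-- Equality of states up to the names of the labels. -/
def State.Same (s s' : State) : Prop :=
  s.loops = s'.loops ∧ ∃ f : ℕ → ℕ,
    (∀ x ∈ s.labels, ∀ y ∈ s.labels, f x = f y → x = y) ∧ s'.labels = s.labels.map f

theorem State.Same.refl (s : State) : s.Same s := ⟨rfl, id, by simp, by simp⟩

theorem State.Same.of_map (n : ℕ) (l : List ℕ) (f g : ℕ → ℕ)
    (h : ∀ x ∈ l, ∀ y ∈ l, f x = f y ↔ g x = g y) :
    State.Same ⟨n, l.map f⟩ ⟨n, l.map g⟩ := by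
  classical
  refine ⟨rfl, fun z => if hz : ∃ x ∈ l, f x = z then g hz.choose else 0, ?_, ?_⟩
  · intro u hu v hv huv
    simp only [List.mem_map] at hu hv
    simp only [dif_pos hu, dif_pos hv] at huv
    have h1 := hu.choose_spec
    have h2 := hv.choose_spec
    have := (h _ h1.1 _ h2.1).2 huv
    rw [← h1.2, ← h2.2, this]
  · simp only [List.map_map]
    apply List.map_congr_left
    intro x hx
    have hz : ∃ y ∈ l, f y = f x := ⟨x, hx, rfl⟩
    simp only [Function.comp, dif_pos hz]
    exact (h _ hx _ hz.choose_spec.1).1 hz.choose_spec.2.symm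

theorem State.birth_eq {n j : ℕ} {l r : List ℕ} (h : l.length = j) :
    State.birth j ⟨n, l ++ r⟩ =
      ⟨n, l ++ freshLabel (l ++ r) :: freshLabel (l ++ r) :: r⟩ := by
  subst h; simp [State.birth]

theorem State.death_eq {n j a b : ℕ} {l r : List ℕ} (h : l.length = j) :
    State.death j ⟨n, l ++ a :: b :: r⟩ =
      if a = b then ⟨n + 1, l ++ r⟩
      else ⟨n, (l ++ r).map fun x => if x = b then a else x⟩ := by
  subst h; simp [State.death]

theorem exists_split {α : Type*} (l : List α) (j : ℕ) (h : j ≤ l.length) :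
    ∃ u v, l = u ++ v ∧ u.length = j :=
  ⟨l.take j, l.drop j, by simp, by simp [h]⟩

theorem exists_split_two {α : Type*} (l : List α) (j : ℕ) (h : j + 2 ≤ l.length) :
    ∃ u a b v, l = u ++ a :: b :: v ∧ u.length = j := by
  obtain ⟨u, v, rfl, hu⟩ := exists_split l j (by omega)
  match v, h with
  | [], h => simp at h; omega
  | [_], h => simp at h; omega
  | a :: b :: v, _ => exact ⟨u, a, b, v, rfl, hu⟩

theorem State.birth_length (j : ℕ) (s : State) :
    (s.birth j).labels.length = s.labels.length + 2 := by
  simp [State.birth]; omega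

theorem State.death_length (j : ℕ) (s : State) (h : j + 2 ≤ s.labels.length) :
    (s.death j).labels.length + 2 = s.labels.length := by
  obtain ⟨n, l⟩ := s
  obtain ⟨u, a, b, v, rfl, hu⟩ := exists_split_two l j h
  rw [State.death_eq hu]
  split_ifs <;> simp <;> omega

theorem State.Same.birth {s s' : State} (h : s.Same s') (j : ℕ) :
    (s.birth j).Same (s'.birth j) := by
  obtain ⟨n, l⟩ := s
  obtain ⟨n', l'⟩ := s'
  obtain ⟨h1, f, hf, h2⟩ := h
  simp only at h1 h2 hf
  subst h1 h2
  have hfr : ∀ x ∈ l, x ≠ freshLabel l := fun x hx => (lt_freshLabel hx).ne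
  have hfr' : ∀ x ∈ l, f x ≠ freshLabel (l.map f) := fun x hx =>
    (lt_freshLabel (List.mem_map_of_mem hx)).ne
  refine ⟨rfl, fun x => if x = freshLabel l then freshLabel (l.map f) else f x, ?_, ?_⟩
  · have key : ∀ x ∈ (State.birth j ⟨n, l⟩).labels, x = freshLabel l ∨ x ∈ l := by
      intro x hx
      simp only [State.birth, List.mem_append, List.mem_cons] at hx
      rcases hx with hx | hx | hx | hx
      · exact .inr (List.mem_of_mem_take hx)
      · exact .inl hx
      · exact .inl hx
      · exact .inr (List.mem_of_mem_drop hx)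
    intro x hx y hy
    have := key x hx
    have := key y hy
    grind
  · simp only [State.birth, List.map_append, List.map_cons, if_true, ← List.map_take,
      ← List.map_drop]
    congr 1
    · apply List.map_congr_left
      intro x hx
      rw [if_neg (hfr x (List.mem_of_mem_take hx))]
    · congr 2
      apply List.map_congr_left
      intro x hx
      rw [if_neg (hfr x (List.mem_of_mem_drop hx))]

theorem State.Same.death {s s' : State} (h : s.Same s') (j : ℕ) (hj : j + 2 ≤ s.labels.length) :
    (s.death j).Same (s'.death j) := by
  obtain ⟨n, l⟩ := s
  obtain ⟨n', l'⟩ := s'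
  obtain ⟨h1, f, hf, h2⟩ := h
  simp only at h1 h2 hf hj
  subst h1 h2
  obtain ⟨u, a, b, v, rfl, hu⟩ := exists_split_two l j hj
  have e := State.death_eq (n := n) (j := j) (l := u.map f) (a := f a) (b := f b)
    (r := v.map f) (by simpa using hu)
  simp only [← List.map_append, ← List.map_cons] at e
  rw [State.death_eq hu, e]
  simp only [List.mem_append, List.mem_cons] at hf
  by_cases hab : a = b
  · subst hab
    simp only [if_true]
    refine ⟨rfl, f, ?_, by simp⟩
    intro x hx y hy
    simp only [List.mem_append] at hx hy
    exact hf x (by tauto) y (by tauto)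
  · have hfab : f a ≠ f b := fun h => hab (hf a (by simp) b (by simp) h)
    rw [if_neg hab, if_neg hfab, List.map_map]
    apply State.Same.of_map
    intro x hx y hy
    simp only [List.mem_append] at hx hy
    have hx' := hf x (by tauto)
    have hy' := hf y (by tauto)
    have h1 := hx' y (by tauto)
    have h2 := hx' a (by tauto)
    have h3 := hx' b (by tauto)
    have h4 := hy' a (by tauto)
    have h5 := hy' b (by tauto)
    simp only [Function.comp]
    grind

theorem State.death_birth (j : ℕ) (s : State) (h : j ≤ s.labels.length) :
    (s.birth j).death j = ⟨s.loops + 1, s.labels⟩ := by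
  obtain ⟨n, l⟩ := s
  obtain ⟨u, v, rfl, hu⟩ := exists_split l j h
  rw [State.birth_eq hu, State.death_eq hu, if_pos rfl]

theorem State.zigzag_right (j : ℕ) (s : State) (h : j + 1 ≤ s.labels.length) :
    s.Same ((s.birth j).death (j + 1)) := by
  obtain ⟨n, l⟩ := s
  obtain ⟨u, v, rfl, hu⟩ := exists_split l j (by simp at h; omega)
  match v, h with
  | [], h => simp at h; omega
  | x :: v, _ =>
    have hfr : ∀ y ∈ u ++ x :: v, y ≠ freshLabel (u ++ x :: v) :=
      fun y hy => (lt_freshLabel hy).ne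
    rw [State.birth_eq hu]
    generalize freshLabel (u ++ x :: v) = f at *
    have := State.death_eq (n := n) (j := j + 1) (l := u ++ [f]) (a := f) (b := x) (r := v)
      (by simp [hu])
    simp only [List.append_assoc, List.singleton_append] at this
    rw [this, if_neg (hfr x (by simp)).symm]
    refine ⟨rfl, fun y => if y = x then f else y, ?_, ?_⟩
    · intro y hy z hz
      have := hfr y hy
      have := hfr z hz
      grind
    · have := hfr x (by simp)
      simp

theorem State.zigzag_left (j : ℕ) (s : State) (h : j + 1 ≤ s.labels.length) :
    (s.birth (j + 1)).death j = s := by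
  obtain ⟨n, l⟩ := s
  obtain ⟨u, v, rfl, hu⟩ := exists_split l j (by simp at h; omega)
  match v, h with
  | [], h => simp at h; omega
  | x :: v, _ =>
    have hfr : ∀ y ∈ u ++ x :: v, y ≠ freshLabel (u ++ x :: v) :=
      fun y hy => (lt_freshLabel hy).ne
    have := State.birth_eq (n := n) (j := j + 1) (l := u ++ [x]) (r := v) (by simp [hu])
    simp only [List.append_assoc, List.singleton_append] at this
    rw [this]
    generalize freshLabel (u ++ x :: v) = f at *
    rw [State.death_eq hu, if_neg (hfr x (by simp))]
    congr 1
    simp only [List.map_append, List.map_cons, if_true]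
    have e : ∀ w : List ℕ, (∀ y ∈ w, y ∈ u ++ x :: v) →
        w.map (fun y => if y = f then x else y) = w := by
      intro w hw
      conv_rhs => rw [← List.map_id w]
      apply List.map_congr_left
      intro y hy
      rw [if_neg (hfr y (hw y hy))]
      rfl
    rw [e u (by simp +contextual), e v (by simp +contextual)]

theorem State.birth_birth (i k : ℕ) (s : State) (h : i + k ≤ s.labels.length) :
    ((s.birth i).birth (i + 2 + k)).Same ((s.birth (i + k)).birth i) := by
  obtain ⟨n, l⟩ := s
  obtain ⟨u, v, rfl, hu⟩ := exists_split l i (by simp at h ⊢; omega)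
  obtain ⟨v, w, rfl, hv⟩ := exists_split v k (by simp at h; omega)
  have e1 := State.birth_eq (n := n) (j := i + k) (l := u ++ v) (r := w) (by simp [hu, hv])
  have hfr : ∀ y ∈ u ++ (v ++ w), y < freshLabel (u ++ (v ++ w)) := fun y hy => lt_freshLabel hy
  simp only [List.append_assoc] at e1
  rw [State.birth_eq hu, e1]
  generalize freshLabel (u ++ (v ++ w)) = f at *
  have e2 := State.birth_eq (n := n) (j := i + 2 + k) (l := u ++ f :: f :: v) (r := w)
    (by simp [hu, hv]; omega)
  have hf2 : ∀ y ∈ u ++ f :: f :: (v ++ w), y < freshLabel (u ++ f :: f :: (v ++ w)) :=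
    fun y hy => lt_freshLabel hy
  have hf3 : ∀ y ∈ u ++ (v ++ f :: f :: w), y < freshLabel (u ++ (v ++ f :: f :: w)) :=
    fun y hy => lt_freshLabel hy
  simp only [List.append_assoc, List.cons_append] at e2
  rw [e2, State.birth_eq hu]
  generalize freshLabel (u ++ f :: f :: (v ++ w)) = f2 at *
  generalize freshLabel (u ++ (v ++ f :: f :: w)) = f3 at *
  have h2 := hf2 f (by simp)
  have h3 := hf3 f (by simp)
  refine ⟨rfl, fun x => if x = f then f3 else if x = f2 then f else x, ?_, ?_⟩
  · intro x hx y hy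
    simp only [List.mem_append, List.mem_cons] at *
    grind
  · have e : ∀ z : List ℕ, (∀ y ∈ z, y ∈ u ++ (v ++ w)) →
        z.map (fun x => if x = f then f3 else if x = f2 then f else x) = z := by
      intro z hz
      conv_rhs => rw [← List.map_id z]
      apply List.map_congr_left
      intro y hy
      have := hfr y (hz y hy)
      rw [if_neg (by omega), if_neg (by omega)]
      rfl
    simp only [List.map_append, List.map_cons, if_true]
    rw [e u (by simp +contextual), e v (by simp +contextual), e w (by simp +contextual),
      if_neg (by omega)]

theorem State.birth_death (i k : ℕ) (s : State) (h : i + k + 2 ≤ s.labels.length) :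
    ((s.birth i).death (i + 2 + k)).Same ((s.death (i + k)).birth i) := by
  obtain ⟨n, l⟩ := s
  obtain ⟨u, v, rfl, hu⟩ := exists_split l i (by simp at h ⊢; omega)
  obtain ⟨v, a, b, w, rfl, hv⟩ := exists_split_two v k (by simp at h; omega)
  have e1 := State.death_eq (n := n) (j := i + k) (l := u ++ v) (a := a) (b := b) (r := w)
    (by simp [hu, hv])
  have hfr : ∀ y ∈ u ++ (v ++ a :: b :: w), y < freshLabel (u ++ (v ++ a :: b :: w)) :=
    fun y hy => lt_freshLabel hy
  simp only [List.append_assoc] at e1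
  rw [State.birth_eq hu, e1]
  generalize freshLabel (u ++ (v ++ a :: b :: w)) = f at *
  have e2 := State.death_eq (n := n) (j := i + 2 + k) (l := u ++ f :: f :: v) (a := a) (b := b)
    (r := w) (by simp [hu, hv]; omega)
  simp only [List.append_assoc, List.cons_append] at e2
  rw [e2]
  simp only [List.mem_append, List.mem_cons] at hfr
  have ha := hfr a (by simp)
  have hb := hfr b (by simp)
  by_cases hab : a = b
  · rw [if_pos hab, if_pos hab, State.birth_eq hu]
    have hf2 : ∀ y ∈ u ++ (v ++ w), y < freshLabel (u ++ (v ++ w)) :=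
      fun y hy => lt_freshLabel hy
    generalize freshLabel (u ++ (v ++ w)) = f2 at *
    have := State.Same.of_map (n + 1) (u ++ f :: f :: (v ++ w)) id
      (fun x => if x = f then f2 else x) (by
        intro x hx y hy
        simp only [List.mem_append, List.mem_cons, id] at *
        grind)
    rw [List.map_id] at this
    convert this using 2
    have e : ∀ z : List ℕ, (∀ y ∈ z, y ∈ u ++ (v ++ w)) →
        z.map (fun x => if x = f then f2 else x) = z := by
      intro z hz
      conv_rhs => rw [← List.map_id z]
      apply List.map_congr_left
      intro y hy
      have hy' := hz y hy
      simp only [List.mem_append] at hy'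
      have := hfr y (by tauto)
      rw [if_neg (by omega)]
      rfl
    simp only [List.map_append, List.map_cons, if_true]
    rw [e u (by simp +contextual), e v (by simp +contextual), e w (by simp +contextual)]
  · rw [if_neg hab, if_neg hab, List.map_append (l₁ := u) (l₂ := v ++ w),
      State.birth_eq (by simpa using hu)]
    have hf2 : ∀ y ∈ (u.map (fun x => if x = b then a else x)) ++
        ((v ++ w).map (fun x => if x = b then a else x)), y < _ :=
      fun y hy => lt_freshLabel hy
    generalize freshLabel ((u.map (fun x => if x = b then a else x)) ++
        ((v ++ w).map (fun x => if x = b then a else x))) = f2 at *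
    have hf3 : ∀ y ∈ u ++ (v ++ w), (if y = b then a else y) < f2 := by
      intro y hy
      apply hf2
      rw [← List.map_append]
      exact List.mem_map.2 ⟨y, hy, rfl⟩
    have := State.Same.of_map n (u ++ f :: f :: (v ++ w)) (fun x => if x = b then a else x)
      (fun x => if x = f then f2 else if x = b then a else x) (by
        intro x hx y hy
        have := hf3 x
        have := hf3 y
        simp only [List.mem_append, List.mem_cons] at *
        grind)
    convert this using 2
    have e : ∀ z : List ℕ, (∀ y ∈ z, y ∈ u ++ (v ++ w)) →
        z.map (fun x => if x = f then f2 else if x = b then a else x) =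
          z.map (fun x => if x = b then a else x) := by
      intro z hz
      apply List.map_congr_left
      intro y hy
      have hy' := hz y hy
      simp only [List.mem_append] at hy'
      have := hfr y (by tauto)
      rw [if_neg (by omega)]
    simp only [List.map_append, List.map_cons, if_true]
    rw [e u (by simp +contextual), e v (by simp +contextual), e w (by simp +contextual)]

theorem State.death_birth_far (i k : ℕ) (s : State) (h : i + k + 2 ≤ s.labels.length) :
    ((s.death i).birth (i + k)).Same ((s.birth (i + 2 + k)).death i) := by
  obtain ⟨n, l⟩ := s
  obtain ⟨u, a, b, v, rfl, hu⟩ := exists_split_two l i (by simp at h ⊢; omega)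
  obtain ⟨v, w, rfl, hv⟩ := exists_split v k (by simp at h; omega)
  have hfr : ∀ y ∈ u ++ a :: b :: (v ++ w), y < freshLabel (u ++ a :: b :: (v ++ w)) :=
    fun y hy => lt_freshLabel hy
  have e1 := State.birth_eq (n := n) (j := i + 2 + k) (l := u ++ a :: b :: v) (r := w)
    (by simp [hu, hv]; omega)
  simp only [List.append_assoc, List.cons_append] at e1
  rw [State.death_eq hu, e1]
  generalize freshLabel (u ++ a :: b :: (v ++ w)) = f at *
  rw [State.death_eq hu]
  simp only [List.mem_append, List.mem_cons] at hfr
  have ha := hfr a (by simp)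
  have hb := hfr b (by simp)
  by_cases hab : a = b
  · rw [if_pos hab, if_pos hab]
    have e2 := State.birth_eq (n := n + 1) (j := i + k) (l := u ++ v) (r := w)
      (by simp [hu, hv])
    have hf2 : ∀ y ∈ u ++ (v ++ w), y < freshLabel (u ++ (v ++ w)) :=
      fun y hy => lt_freshLabel hy
    simp only [List.append_assoc] at e2
    rw [e2]
    generalize freshLabel (u ++ (v ++ w)) = f2 at *
    have := State.Same.of_map (n + 1) (u ++ (v ++ f :: f :: w))
      (fun x => if x = f then f2 else x) id (by
        intro x hx y hy
        simp only [List.mem_append, List.mem_cons, id] at *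
        grind)
    rw [List.map_id] at this
    convert this using 2
    have e : ∀ z : List ℕ, (∀ y ∈ z, y ∈ u ++ (v ++ w)) →
        z.map (fun x => if x = f then f2 else x) = z := by
      intro z hz
      conv_rhs => rw [← List.map_id z]
      apply List.map_congr_left
      intro y hy
      have hy' := hz y hy
      simp only [List.mem_append] at hy'
      have := hfr y (by tauto)
      rw [if_neg (by omega)]
      rfl
    simp only [List.map_append, List.map_cons, if_true]
    rw [e u (by simp +contextual), e v (by simp +contextual), e w (by simp +contextual)]
  · rw [if_neg hab, if_neg hab, ← List.append_assoc, List.map_append,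
      State.birth_eq (by simp [hu, hv])]
    have hf2 : ∀ y ∈ ((u ++ v).map (fun x => if x = b then a else x)) ++
        (w.map (fun x => if x = b then a else x)), y < _ :=
      fun y hy => lt_freshLabel hy
    generalize freshLabel (((u ++ v).map (fun x => if x = b then a else x)) ++
        (w.map (fun x => if x = b then a else x))) = f2 at *
    have hf3 : ∀ y ∈ u ++ (v ++ w), (if y = b then a else y) < f2 := by
      intro y hy
      apply hf2
      rw [← List.map_append, List.append_assoc]
      exact List.mem_map.2 ⟨y, hy, rfl⟩
    have := State.Same.of_map n (u ++ (v ++ f :: f :: w))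
      (fun x => if x = f then f2 else if x = b then a else x)
      (fun x => if x = b then a else x) (by
        intro x hx y hy
        have := hf3 x
        have := hf3 y
        simp only [List.mem_append, List.mem_cons] at *
        grind)
    convert this using 2
    have e : ∀ z : List ℕ, (∀ y ∈ z, y ∈ u ++ (v ++ w)) →
        z.map (fun x => if x = f then f2 else if x = b then a else x) =
          z.map (fun x => if x = b then a else x) := by
      intro z hz
      apply List.map_congr_left
      intro y hy
      have hy' := hz y hy
      simp only [List.mem_append] at hy'
      have := hfr y (by tauto)
      rw [if_neg (by omega)]
    simp only [List.map_append, List.map_cons, if_true, List.append_assoc]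
    rw [e u (by simp +contextual), e v (by simp +contextual), e w (by simp +contextual)]

theorem State.death_death (i k : ℕ) (s : State) (h : i + k + 4 ≤ s.labels.length) :
    ((s.death i).death (i + k)).Same ((s.death (i + 2 + k)).death i) := by
  obtain ⟨n, l⟩ := s
  obtain ⟨u, a, b, v, rfl, hu⟩ := exists_split_two l i (by simp at h ⊢; omega)
  obtain ⟨v, c, d, w, rfl, hv⟩ := exists_split_two v k (by simp at h; omega)
  have huv : (u ++ v).length = i + k := by simp [hu, hv]
  have e1 := State.death_eq (n := n) (j := i + 2 + k) (l := u ++ a :: b :: v)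
    (a := c) (b := d) (r := w) (by simp [hu, hv]; omega)
  simp only [List.append_assoc, List.cons_append] at e1
  rw [State.death_eq hu, e1]
  have hm : ∀ (m : ℕ) (φ : ℕ → ℕ),
      State.death (i + k) ⟨m, (u ++ (v ++ c :: d :: w)).map φ⟩ =
        if φ c = φ d then ⟨m + 1, (u ++ (v ++ w)).map φ⟩ else
        ⟨m, (u ++ (v ++ w)).map fun x => if φ x = φ d then φ c else φ x⟩ := by
    intro m φ
    have := State.death_eq (n := m) (j := i + k) (l := (u ++ v).map φ) (a := φ c) (b := φ d)
      (r := w.map φ) (by simpa using huv)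
    simp only [← List.map_append, ← List.map_cons, List.append_assoc, List.map_map] at this
    exact this
  have hm' : ∀ (m : ℕ) (φ : ℕ → ℕ),
      State.death i ⟨m, (u ++ a :: b :: (v ++ w)).map φ⟩ =
        if φ a = φ b then ⟨m + 1, (u ++ (v ++ w)).map φ⟩ else
        ⟨m, (u ++ (v ++ w)).map fun x => if φ x = φ b then φ a else φ x⟩ := by
    intro m φ
    have := State.death_eq (n := m) (j := i) (l := u.map φ) (a := φ a) (b := φ b)
      (r := (v ++ w).map φ) (by simpa using hu)
    simp only [← List.map_append, ← List.map_cons, List.map_map] at this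
    exact this
  have e3 : (if a = b then (⟨n + 1, u ++ (v ++ c :: d :: w)⟩ : State) else
      ⟨n, (u ++ (v ++ c :: d :: w)).map fun x => if x = b then a else x⟩) =
      ⟨if a = b then n + 1 else n,
        (u ++ (v ++ c :: d :: w)).map fun x => if x = b then a else x⟩ := by
    split_ifs with hab
    · subst hab
      have : (fun x => if x = a then a else x) = id := by
        funext x; split_ifs with hx <;> simp [hx]
      rw [this, List.map_id]
    · rfl
  have e4 : (if c = d then (⟨n + 1, u ++ a :: b :: (v ++ w)⟩ : State) else
      ⟨n, (u ++ a :: b :: (v ++ w)).map fun x => if x = d then c else x⟩) =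
      ⟨if c = d then n + 1 else n,
        (u ++ a :: b :: (v ++ w)).map fun x => if x = d then c else x⟩ := by
    split_ifs with hab
    · subst hab
      have : (fun x => if x = c then c else x) = id := by
        funext x; split_ifs with hx <;> simp [hx]
      rw [this, List.map_id]
    · rfl
  have e5 : ∀ (m : ℕ) (φ : ℕ → ℕ) (x y : ℕ) (z : List ℕ),
      (if φ x = φ y then (⟨m + 1, z.map φ⟩ : State) else
        ⟨m, z.map fun t => if φ t = φ y then φ x else φ t⟩) =
      ⟨if φ x = φ y then m + 1 else m, z.map fun t => if φ t = φ y then φ x else φ t⟩ := by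
    intro m φ x y z
    split_ifs with hxy
    · congr 2
      funext t
      split_ifs with ht
      · rw [ht, hxy]
      · rfl
    · rfl
  rw [e3, e4, (hm _ _).trans (e5 _ _ c d _), (hm' _ _).trans (e5 _ _ a b _)]
  have hn : (if (if c = b then a else c) = (if d = b then a else d) then
        (if a = b then n + 1 else n) + 1 else (if a = b then n + 1 else n)) =
      (if (if a = d then c else a) = (if b = d then c else b) then
        (if c = d then n + 1 else n) + 1 else (if c = d then n + 1 else n)) := by
    grind
  rw [hn]
  apply State.Same.of_map
  intro x _ y _
  grind

theorem State.Same.trans {s t u : State} (h : s.Same t) (h' : t.Same u) : s.Same u := by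
  obtain ⟨n, l⟩ := s
  obtain ⟨n', l'⟩ := t
  obtain ⟨n'', l''⟩ := u
  obtain ⟨h1, f, hf, h2⟩ := h
  obtain ⟨h1', f', hf', h2'⟩ := h'
  simp only at h1 h2 hf h1' h2' hf'
  subst h1 h2 h1' h2'
  refine ⟨rfl, f' ∘ f, ?_, by simp⟩
  intro x hx y hy hxy
  exact hf x hx y hy
    (hf' _ (List.mem_map_of_mem hx) _ (List.mem_map_of_mem hy) hxy)

theorem State.Same.length {s t : State} (h : s.Same t) : t.labels.length = s.labels.length := by
  obtain ⟨-, f, -, h⟩ := h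
  simp [h]

theorem State.hook_length (j : ℕ) (s : State) (h : j + 2 ≤ s.labels.length) :
    (s.hook j).labels.length = s.labels.length := by
  rw [State.hook, State.birth_length, State.death_length j s h]

theorem State.birth_hook (i k : ℕ) (s : State) (h : i + k + 2 ≤ s.labels.length) :
    ((s.birth i).hook (i + 2 + k)).Same ((s.hook (i + k)).birth i) :=
  ((s.birth_death i k h).birth _).trans
    (State.birth_birth i k _ (by have := s.death_length (i + k) h; omega))

theorem State.hook_birth (i k : ℕ) (s : State) (h : i + k + 2 ≤ s.labels.length) :
    ((s.hook i).birth (i + 2 + k)).Same ((s.birth (i + 2 + k)).hook i) :=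
  (State.birth_birth i k _ (by have := s.death_length i (by omega); omega)).trans
    ((s.death_birth_far i k h).birth i)

theorem State.death_hook (i k : ℕ) (s : State) (h : i + k + 4 ≤ s.labels.length) :
    ((s.death i).hook (i + k)).Same ((s.hook (i + 2 + k)).death i) :=
  ((s.death_death i k h).birth _).trans
    (State.death_birth_far i k _ (by have := s.death_length (i + 2 + k) (by omega); omega))

theorem State.hook_death (i k : ℕ) (s : State) (h : i + k + 4 ≤ s.labels.length) :
    ((s.hook i).death (i + 2 + k)).Same ((s.death (i + 2 + k)).hook i) :=
  (State.birth_death i k _ (by have := s.death_length i (by omega); omega)).trans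
    ((s.death_death i k h).birth i)

theorem State.hook_hook (i k : ℕ) (s : State) (h : i + k + 4 ≤ s.labels.length) :
    ((s.hook i).hook (i + 2 + k)).Same ((s.hook (i + 2 + k)).hook i) :=
  ((s.hook_death i k h).birth _).trans
    (State.hook_birth i k _ (by have := s.death_length (i + 2 + k) (by omega); omega))

/-- The effect of a piece on the orientations, with its contribution to the writhe. -/
inductive Effect : Piece → List Bool → List Bool → ℤ → Prop
  | birth (b : Bool) : Effect (.birth b) [] [b, !b] 0
  | death (a : Bool) : Effect .death [a, !a] [] 0
  | cross (c a b : Bool) : Effect (.cross c) [a, b] [b, a] (crossingSign c a b)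

theorem Effect.src {p : Piece} {P Q : List Bool} {σ : ℤ} (h : Effect p P Q σ) :
    P.length = p.src := by cases h <;> rfl

theorem Effect.tgt {p : Piece} {P Q : List Bool} {σ : ℤ} (h : Effect p P Q σ) :
    Q.length = p.tgt := by cases h <;> rfl

theorem closes_cons {j : ℕ} {p : Piece} {w : List Slice} {o : List Bool}
    (h : Closes (⟨j, p⟩ :: w) o) :
    ∃ u P Q v σ, o = u ++ (P ++ v) ∧ u.length = j ∧ Effect p P Q σ ∧
      Closes w (u ++ (Q ++ v)) := by
  cases p with
  | birth b =>
    obtain ⟨h1, h2⟩ := h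
    exact ⟨o.take j, [], [b, !b], o.drop j, 0, by simp, by simp [h1], .birth b, h2⟩
  | death =>
    rw [Closes] at h
    have h0 := List.take_append_drop j o
    have hj : o.drop j ≠ [] → (o.take j).length = j := fun hj => by
      simp only [ne_eq, List.drop_eq_nil_iff, not_le] at hj
      simp; omega
    generalize o.take j = u at *
    generalize o.drop j = v at *
    match v, h with
    | a :: b :: v, h =>
      obtain ⟨rfl, h⟩ := h
      exact ⟨u, [a, !a], [], v, 0, h0.symm, hj (by simp), .death a, h⟩
  | cross c =>
    rw [Closes] at h
    have h0 := List.take_append_drop j o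
    have hj : o.drop j ≠ [] → (o.take j).length = j := fun hj => by
      simp only [ne_eq, List.drop_eq_nil_iff, not_le] at hj
      simp; omega
    generalize o.take j = u at *
    generalize o.drop j = v at *
    match v, h with
    | a :: b :: v, h =>
      exact ⟨u, [a, b], [b, a], v, _, h0.symm, hj (by simp), .cross c a b, h⟩

theorem writhe_cons {j : ℕ} {p : Piece} (w : List Slice) {u P Q : List Bool} (v : List Bool)
    {σ : ℤ} (hu : u.length = j) (h : Effect p P Q σ) :
    writhe (⟨j, p⟩ :: w) (u ++ (P ++ v)) = σ + writhe w (u ++ (Q ++ v)) := by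
  subst hu
  cases h <;> simp [writhe]

theorem Effect.unique {p : Piece} {P Q Q' : List Bool} {σ σ' : ℤ} (h : Effect p P Q σ)
    (h' : Effect p P Q' σ') : Q = Q' ∧ σ = σ' := by
  cases h <;> cases h' <;> simp

/-- Length bookkeeping for one slice. -/
theorem closes_length {j : ℕ} {p : Piece} {w : List Slice} {o : List Bool}
    (h : Closes (⟨j, p⟩ :: w) o) : j + p.src ≤ o.length := by
  obtain ⟨u, P, Q, v, σ, rfl, rfl, he, -⟩ := closes_cons h
  have := he.src
  simp; omega

theorem stateSum_congr (g : ℕ → ℤ[T;T⁻¹]) (w : List Slice) :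
    ∀ (o : List Bool) (s s' : State), Closes w o → s.labels.length = o.length → s.Same s' →
      stateSum g w s = stateSum g w s' := by
  induction w with
  | nil =>
    intro o s s' _ _ h
    simp only [stateSum, h.1]
  | cons x w ih =>
    obtain ⟨j, p⟩ := x
    intro o s s' hc hl h
    have hlen := closes_length hc
    obtain ⟨u, P, Q, v, σ, rfl, hu, he, hw⟩ := closes_cons hc
    have h1 := he.src
    have h2 := he.tgt
    simp only [List.length_append] at hl hlen
    cases p with
    | birth b =>
      simp only [Piece.src, Piece.tgt] at h1 h2
      exact ih _ _ _ hw (by rw [State.birth_length]; simp; omega) (h.birth j)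
    | death =>
      simp only [Piece.src, Piece.tgt] at h1 h2 hlen
      have := s.death_length j (by omega)
      exact ih _ _ _ hw (by simp; omega) (h.death j (by omega))
    | cross c =>
      simp only [Piece.src, Piece.tgt] at h1 h2 hlen
      have := s.hook_length j (by omega)
      simp only [stateSum]
      rw [ih _ s s' hw (by simp; omega) h, ih _ (s.hook j) (s'.hook j) hw (by simp; omega)
        ((h.death j (by omega)).birth j)]

theorem stateSum_loop (w : List Slice) : ∀ (n : ℕ) (l : List ℕ),
    stateSum (fun n => loopValue ^ n) w ⟨n + 1, l⟩ =
      loopValue * stateSum (fun n => loopValue ^ n) w ⟨n, l⟩ := by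
  have hd : ∀ j n l, State.death j ⟨n + 1, l⟩ =
      ⟨(State.death j ⟨n, l⟩).loops + 1, (State.death j ⟨n, l⟩).labels⟩ := by
    intro j n l
    simp only [State.death]
    split
    · split_ifs <;> rfl
    · rfl
  induction w with
  | nil => intro n l; simp [stateSum, pow_succ, mul_comm]
  | cons x w ih =>
    obtain ⟨j, p⟩ := x
    intro n l
    cases p with
    | birth b => exact ih _ _
    | death =>
      simp only [stateSum, hd]
      exact ih _ _
    | cross c =>
      have hh : State.hook j ⟨n + 1, l⟩ =
          ⟨(State.hook j ⟨n, l⟩).loops + 1, (State.hook j ⟨n, l⟩).labels⟩ := by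
        simp only [State.hook, hd, State.birth]
      simp only [stateSum, hh, ih]
      ring

/-- The unnormalised state sum, with weight `(-A ^ 2 - A ^ (-2)) ^ loops`. -/
noncomputable abbrev rawSum (w : List Slice) (s : State) : ℤ[T;T⁻¹] :=
  stateSum (fun n => loopValue ^ n) w s

theorem powA_add (m n : ℤ) : powA (m + n) = powA m * powA n := by
  simp only [powA, ← T_add]; congr 1; ring

theorem powA_zero : powA 0 = 1 := by simp [powA]

/-- The coefficients of the two smoothings. -/
theorem coeff_mul (c : Bool) :
    powA (if c then 1 else -1) * powA (if c then -1 else 1) = 1 := by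
  rw [← powA_add, ← powA_zero]
  congr 1
  cases c <;> simp

theorem loopValue_eq (c : Bool) :
    loopValue = -powA (if c then 1 else -1) ^ 2 - powA (if c then -1 else 1) ^ 2 := by
  rw [loopValue, pow_two, pow_two, ← powA_add, ← powA_add]
  cases c <;> norm_num
  ring

theorem writheFactor_add (m n : ℤ) :
    writheFactor (m + n) = writheFactor m * writheFactor n := by
  simp only [writheFactor, Int.negOnePow_add, mul_add, powA_add, Units.val_mul, zsmul_eq_mul,
    Int.cast_mul]
  ring

theorem writheFactor_zero : writheFactor 0 = 1 := by simp [writheFactor, powA_zero]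

theorem writheFactor_kink (c : Bool) :
    writheFactor (if c then -1 else 1) * -powA (if c then -1 else 1) ^ 3 = 1 := by
  cases c <;>
    simp [writheFactor, pow_succ, ← powA_add, Int.negOnePow_neg, powA_zero]

/-- Two words with the same orientations at the top have the same value. -/
def Agree (x y : List Slice) : Prop :=
  ∀ (o : List Bool) (s : State), s.labels.length = o.length → Closes x o → Closes y o →
    writheFactor (writhe x o) * rawSum x s = writheFactor (writhe y o) * rawSum y s

theorem Agree.cons {x y : List Slice} (h : Agree x y) (z : Slice) : Agree (z :: x) (z :: y) := by
  obtain ⟨j, p⟩ := z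
  intro o s hl hx hy
  have hlen := closes_length hx
  obtain ⟨u, P, Q, v, σ, rfl, hu, he, hw⟩ := closes_cons hx
  obtain ⟨u', P', Q', v', σ', ho, hu', he', hw'⟩ := closes_cons hy
  obtain ⟨ho1, ho2⟩ := List.append_inj ho (hu.trans hu'.symm)
  obtain ⟨ho3, ho4⟩ := List.append_inj ho2 (he.src.trans he'.src.symm)
  subst ho1 ho3 ho4
  obtain ⟨rfl, rfl⟩ := he.unique he'
  rw [writhe_cons x v hu he, writhe_cons y v hu he, writheFactor_add, writheFactor_add]
  have h1 := he.src
  have h2 := he.tgt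
  simp only [List.length_append] at hl hlen
  cases p with
  | birth b =>
    simp only [Piece.src, Piece.tgt] at h1 h2
    have := h _ (s.birth j) (by rw [State.birth_length]; simp; omega) hw hw'
    simp only [rawSum, stateSum] at this ⊢
    linear_combination writheFactor σ * this
  | death =>
    simp only [Piece.src, Piece.tgt] at h1 h2 hlen
    have hd := s.death_length j (by omega)
    have := h _ (s.death j) (by simp; omega) hw hw'
    simp only [rawSum, stateSum] at this ⊢
    linear_combination writheFactor σ * this
  | cross c =>
    simp only [Piece.src, Piece.tgt] at h1 h2 hlen
    have hd := s.hook_length j (by omega)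
    have e1 := h _ s (by simp; omega) hw hw'
    have e2 := h _ (s.hook j) (by simp; omega) hw hw'
    simp only [rawSum, stateSum] at e1 e2 ⊢
    linear_combination writheFactor σ * powA (if c then 1 else -1) * e1 +
      writheFactor σ * powA (if c then -1 else 1) * e2

theorem Agree.append {x y : List Slice} (h : Agree x y) (u : List Slice) :
    Agree (u ++ x) (u ++ y) := by
  induction u with
  | nil => exact h
  | cons z u ih => exact ih.cons z

theorem agree_exchange (p q : Piece) (i k : ℕ) (w : List Slice) :
    Agree (⟨i, p⟩ :: ⟨i + p.tgt + k, q⟩ :: w) (⟨i + p.src + k, q⟩ :: ⟨i, p⟩ :: w) := by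
  intro o s hl hx _
  obtain ⟨u, P, P', v, σ, rfl, hu, he, hx⟩ := closes_cons hx
  obtain ⟨u', Q, Q', v', τ, ho, hu', he', hw⟩ := closes_cons hx
  have h1 := he.src
  have h2 := he.tgt
  have h3 := he'.src
  have h4 := he'.tgt
  obtain ⟨m, hm⟩ : ∃ m, u' = u ++ (P' ++ m) := by
    have hp : u ++ P' <+: u' ++ (Q ++ v') :=
      ⟨v, by rw [← ho, List.append_assoc]⟩
    obtain ⟨m, hm⟩ := List.prefix_of_prefix_length_le hp (List.prefix_append u' (Q ++ v'))
      (by simp; omega)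
    exact ⟨m, by rw [← hm, List.append_assoc]⟩
  subst hm
  have hmk : m.length = k := by simp at hu'; omega
  simp only [List.append_assoc, List.append_cancel_left_eq] at ho
  subst ho
  have w1 := writhe_cons (⟨i + p.tgt + k, q⟩ :: w) (m ++ (Q ++ v')) hu he
  have w2 := writhe_cons w v' hu' he'
  have w3 := writhe_cons (j := i + p.src + k) (u := u ++ (P ++ m)) (⟨i, p⟩ :: w) v'
    (by simp; omega) he'
  have w4 := writhe_cons w (m ++ (Q' ++ v')) hu he
  simp only [List.append_assoc] at w1 w2 w3 w4 hw
  rw [w1, w2, w3, w4, show σ + (τ + writhe w (u ++ (P' ++ (m ++ (Q' ++ v'))))) =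
    τ + (σ + writhe w (u ++ (P' ++ (m ++ (Q' ++ v'))))) by ring]
  congr 1
  have cg : ∀ s s' : State, s.labels.length = (u ++ (P' ++ (m ++ (Q' ++ v')))).length →
      s.Same s' → rawSum w s = rawSum w s' := fun s s' hs h => stateSum_congr _ w _ s s' hw hs h
  simp only [List.length_append] at hl cg
  cases p <;> cases q <;>
    simp only [Piece.src, Piece.tgt, add_zero, rawSum, stateSum] at *
  · refine cg _ _ ?_ (s.birth_birth i k (by omega))
    simp only [State.birth_length]; omega
  · have l1 := State.death_length (i + 2 + k) (s.birth i) (by rw [State.birth_length]; omega)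
    simp only [State.birth_length] at l1
    exact cg _ _ (by omega) (s.birth_death i k (by omega))
  · have l1 := State.hook_length (i + 2 + k) (s.birth i) (by rw [State.birth_length]; omega)
    simp only [State.birth_length] at l1
    rw [cg _ _ (by omega) (s.birth_hook i k (by omega))]
  · have l1 := s.death_length i (by omega)
    refine cg _ _ ?_ (s.death_birth_far i k (by omega))
    simp only [State.birth_length]; omega
  · have l1 := s.death_length i (by omega)
    have l2 := State.death_length (i + k) (s.death i) (by omega)
    exact cg _ _ (by omega) (s.death_death i k (by omega))
  · have l1 := s.death_length i (by omega)
    have l2 := State.hook_length (i + k) (s.death i) (by omega)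
    rw [cg _ _ (by omega) (s.death_hook i k (by omega))]
  · have l1 := s.hook_length i (by omega)
    rw [cg _ _ (by simp only [State.birth_length]; omega) (s.hook_birth i k (by omega))]
  · have l1 := s.hook_length i (by omega)
    have l2 := State.death_length (i + 2 + k) (s.hook i) (by omega)
    rw [cg _ _ (by omega) (s.hook_death i k (by omega))]
  · have l1 := s.hook_length i (by omega)
    have l2 := State.hook_length (i + 2 + k) (s.hook i) (by omega)
    rw [cg _ _ (by omega) (s.hook_hook i k (by omega))]
    ring

theorem agree_zigzag_right (j : ℕ) (b : Bool) (w : List Slice) :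
    Agree (⟨j, .birth b⟩ :: ⟨j + 1, .death⟩ :: w) w := by
  intro o s hl hx hw
  obtain ⟨u, P, P', v, σ, rfl, hu, ⟨⟩, hx⟩ := closes_cons hx
  have hlen := closes_length hx
  rw [writhe_cons _ _ hu (.birth b)]
  obtain ⟨u', Q, Q', v', τ, ho, hu', ⟨a⟩, -⟩ := closes_cons hx
  simp only [Piece.src, List.length_append, List.length_cons, List.length_nil, List.nil_append]
    at hl hlen
  have e : ∃ x v'', v = x :: v'' := by
    match v, hlen with
    | [], h => simp at h; omega
    | x :: v, _ => exact ⟨x, v, rfl⟩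
  obtain ⟨x, v, rfl⟩ := e
  have h1 : u ++ ([b, !b] ++ x :: v) = (u ++ [b]) ++ ((!b) :: x :: v) := by simp
  rw [h1] at ho
  obtain ⟨ho1, ho2⟩ := List.append_inj ho (by simp [hu, hu'])
  subst ho1
  simp only [List.cons_append, List.nil_append, List.cons.injEq] at ho2
  obtain ⟨rfl, rfl, rfl⟩ := ho2
  have h2 := writhe_cons (j := j + 1) w v (u := u ++ [b]) (by simp [hu]) (.death (!b))
  simp only [List.append_assoc, List.cons_append, List.nil_append, Bool.not_not] at h2 ⊢
  rw [h2, zero_add, zero_add]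
  congr 1
  exact (stateSum_congr _ w _ _ _ hw (by simp at hl ⊢; omega)
    (s.zigzag_right j (by simp at hl; omega))).symm

theorem agree_zigzag_left (j : ℕ) (b : Bool) (w : List Slice) :
    Agree (⟨j + 1, .birth b⟩ :: ⟨j, .death⟩ :: w) w := by
  intro o s hl hx hw
  obtain ⟨u, P, P', v, σ, rfl, hu, ⟨⟩, hx⟩ := closes_cons hx
  rw [writhe_cons _ _ hu (.birth b)]
  obtain ⟨u', Q, Q', v', τ, ho, hu', ⟨a⟩, -⟩ := closes_cons hx
  obtain ⟨u, x, rfl⟩ : ∃ u'' x, u = u'' ++ [x] := by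
    rcases List.eq_nil_or_concat u with rfl | ⟨u, x, rfl⟩
    · simp at hu
    · exact ⟨u, x, by simp⟩
  simp only [List.append_assoc, List.singleton_append] at ho
  obtain ⟨ho1, ho2⟩ := List.append_inj ho (by simp at hu; omega)
  subst ho1
  simp only [List.cons_append, List.nil_append, List.cons.injEq] at ho2
  obtain ⟨rfl, rfl, rfl⟩ := ho2
  have h2 := writhe_cons (j := j) w ((! !x) :: v) (u := u) (by simpa using hu) (.death x)
  simp only [List.append_assoc, List.cons_append, List.nil_append] at h2 ⊢
  rw [h2, zero_add, zero_add, Bool.not_not]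
  congr 1
  simp only [rawSum, stateSum]
  rw [s.zigzag_left j (by simp at hl hu; omega)]

theorem State.hook_hook_right (j : ℕ) (s : State) (h : j + 3 ≤ s.labels.length) :
    State.Same (s.hook j) (((s.hook j).hook (j + 1)).hook j) := by
  have h1 := s.death_length j (by omega)
  simp only [State.hook]
  have e1 := State.zigzag_right j (s.death j) (by omega)
  rw [State.zigzag_left j _ (by have := e1.length; omega)]
  exact e1.birth j

theorem State.hook_hook_left (j : ℕ) (s : State) (h : j + 3 ≤ s.labels.length) :
    State.Same (s.hook (j + 1)) (((s.hook (j + 1)).hook j).hook (j + 1)) := by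
  have h1 := s.death_length (j + 1) (by omega)
  simp only [State.hook]
  rw [State.zigzag_left j _ (by omega)]
  exact (State.zigzag_right j (s.death (j + 1)) (by omega)).birth _

theorem rawSum_hook_hook (w : List Slice) (j : ℕ) (s : State) (h : j + 2 ≤ s.labels.length) :
    rawSum w ((s.hook j).hook j) = loopValue * rawSum w (s.hook j) := by
  have h1 := s.death_length j h
  rw [← stateSum_loop]
  simp only [State.hook, rawSum]
  rw [State.death_birth j _ (by omega)]
  rfl

/-- Splitting off three neighbouring entries. -/
theorem three_split (o : List Bool) (j : ℕ) (h : j + 3 ≤ o.length) :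
    ∃ u a b c v, o = u ++ a :: b :: c :: v ∧ u.length = j := by
  obtain ⟨u, a, b, v, rfl, hu⟩ := exists_split_two o j (by omega)
  match v, h with
  | [], h => simp at h; omega
  | c :: v, _ => exact ⟨u, a, b, c, v, rfl, hu⟩

theorem writhe_cross {j : ℕ} (c : Bool) (w : List Slice) {u : List Bool} (a b : Bool)
    (v : List Bool) (hu : u.length = j) :
    writhe (⟨j, .cross c⟩ :: w) (u ++ a :: b :: v) =
      crossingSign c a b + writhe w (u ++ b :: a :: v) :=
  writhe_cons w v hu (.cross c a b)

theorem writhe_cross_succ {j : ℕ} (c : Bool) (w : List Slice) {u : List Bool} (x a b : Bool)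
    (v : List Bool) (hu : u.length = j) :
    writhe (⟨j + 1, .cross c⟩ :: w) (u ++ x :: a :: b :: v) =
      crossingSign c a b + writhe w (u ++ x :: b :: a :: v) := by
  have := writhe_cons (j := j + 1) (u := u ++ [x]) w v (by simp [hu]) (.cross c a b)
  simpa using this

theorem closes_cross {j : ℕ} {c : Bool} {w : List Slice} {u : List Bool} {a b : Bool}
    {v : List Bool} (hu : u.length = j) (h : Closes (⟨j, .cross c⟩ :: w) (u ++ a :: b :: v)) :
    Closes w (u ++ b :: a :: v) := by
  subst hu; simpa [Closes] using h

theorem closes_cross_succ {j : ℕ} {c : Bool} {w : List Slice} {u : List Bool} {x a b : Bool}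
    {v : List Bool} (hu : u.length = j)
    (h : Closes (⟨j + 1, .cross c⟩ :: w) (u ++ x :: a :: b :: v)) :
    Closes w (u ++ x :: b :: a :: v) := by
  have := closes_cross (j := j + 1) (u := u ++ [x]) (a := a) (b := b) (v := v) (by simp [hu])
    (by simpa using h)
  simpa using this

theorem agree_two (j : ℕ) (c : Bool) (w : List Slice) :
    Agree (⟨j, .cross c⟩ :: ⟨j, .cross (!c)⟩ :: w) w := by
  intro o s hl hx hw
  have hlen := closes_length hx
  simp only [Piece.src] at hlen
  obtain ⟨u, a, b, v, rfl, hu⟩ := exists_split_two o j hlen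
  rw [writhe_cross c _ a b v hu, writhe_cross (!c) _ b a v hu,
    show crossingSign c a b + (crossingSign (!c) b a + writhe w (u ++ a :: b :: v)) =
      writhe w (u ++ a :: b :: v) by cases a <;> cases b <;> cases c <;> simp [crossingSign]]
  congr 1
  have h1 := rawSum_hook_hook w j s (by omega)
  have h2 := coeff_mul c
  have h3 := loopValue_eq c
  have e1 : powA (if (!c) = true then 1 else -1) = powA (if c = true then -1 else 1) := by
    cases c <;> rfl
  have e2 : powA (if (!c) = true then -1 else 1) = powA (if c = true then 1 else -1) := by
    cases c <;> rfl
  simp only [rawSum, stateSum, e1, e2] at h1 ⊢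
  rw [h1, h3]
  generalize powA (if c = true then 1 else -1) = A at *
  generalize powA (if c = true then -1 else 1) = B at *
  generalize stateSum _ w s = X
  generalize stateSum _ w (s.hook j) = Y
  linear_combination (X - (A ^ 2 + B ^ 2) * Y) * h2

theorem rawSum_three (j : ℕ) (c : Bool) (w : List Slice) (o : List Bool) (s : State)
    (hw : Closes w o) (hl : s.labels.length = o.length) (hj : j + 3 ≤ s.labels.length) :
    rawSum (⟨j, .cross c⟩ :: ⟨j + 1, .cross c⟩ :: ⟨j, .cross c⟩ :: w) s =
      rawSum (⟨j + 1, .cross c⟩ :: ⟨j, .cross c⟩ :: ⟨j + 1, .cross c⟩ :: w) s := by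
  have h2 := coeff_mul c
  have h3 := loopValue_eq c
  have l1 := s.hook_length j (by omega)
  have l2 := s.hook_length (j + 1) (by omega)
  have r1 := rawSum_hook_hook w j s (by omega)
  have r2 := rawSum_hook_hook w (j + 1) s (by omega)
  have r3 := stateSum_congr (fun n => loopValue ^ n) w o _ _ hw (by omega)
    (s.hook_hook_right j (by omega))
  have r4 := stateSum_congr (fun n => loopValue ^ n) w o _ _ hw (by omega)
    (s.hook_hook_left j (by omega))
  simp only [rawSum, stateSum] at r1 r2 ⊢
  rw [r1, r2, ← r3, ← r4]
  generalize powA (if c = true then 1 else -1) = A at *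
  generalize powA (if c = true then -1 else 1) = B at *
  generalize stateSum _ w s = X
  generalize stateSum _ w (s.hook j) = Y
  generalize stateSum _ w (s.hook (j + 1)) = Z
  generalize stateSum _ w ((s.hook j).hook (j + 1)) = U
  generalize stateSum _ w ((s.hook (j + 1)).hook j) = V
  rw [h3]
  linear_combination -(Y - Z) * (A * A * B + B ^ 3) * h2

theorem agree_three (j : ℕ) (c : Bool) (w : List Slice) :
    Agree (⟨j, .cross c⟩ :: ⟨j + 1, .cross c⟩ :: ⟨j, .cross c⟩ :: w)
      (⟨j + 1, .cross c⟩ :: ⟨j, .cross c⟩ :: ⟨j + 1, .cross c⟩ :: w) := by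
  intro o s hl hx hy
  have hlen := closes_length hy
  simp only [Piece.src] at hlen
  obtain ⟨u, x, y, z, v, rfl, hu⟩ := three_split o j (by omega)
  have hw : Closes w (u ++ z :: y :: x :: v) :=
    closes_cross hu (closes_cross_succ hu (closes_cross hu hx))
  rw [rawSum_three j c w _ s hw (by simpa using hl) (by omega)]
  congr 2
  rw [writhe_cross c _ x y _ hu, writhe_cross_succ c _ y x z v hu, writhe_cross c _ y z _ hu,
    writhe_cross_succ c _ x y z v hu, writhe_cross c _ x z _ hu,
    writhe_cross_succ c _ z x y v hu]
  ring

theorem coeff_not (c : Bool) :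
    powA (if (!c) = true then 1 else -1) = powA (if c = true then -1 else 1) ∧
      powA (if (!c) = true then -1 else 1) = powA (if c = true then 1 else -1) := by
  cases c <;> simp

theorem agree_slide_birth (j : ℕ) (b c : Bool) (w : List Slice) :
    Agree (⟨j, .birth b⟩ :: ⟨j + 1, .cross c⟩ :: w)
      (⟨j + 1, .birth b⟩ :: ⟨j, .cross (!c)⟩ :: w) := by
  intro o s hl hx hy
  have hlen : j + 1 ≤ o.length := closes_length hy
  obtain ⟨u, v, rfl, hu⟩ := exists_split o j (by omega)
  obtain ⟨x, v, rfl⟩ : ∃ x v', v = x :: v' := by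
    match v, hlen with
    | [], h => simp at h; omega
    | x :: v, _ => exact ⟨x, v, rfl⟩
  have hx' : Closes (⟨j + 1, .cross c⟩ :: w) (u ++ b :: (!b) :: x :: v) := by
    subst hu
    simpa [Closes] using hx
  have hw := closes_cross_succ hu hx'
  have w1 := writhe_cons (j := j) (⟨j + 1, .cross c⟩ :: w) (x :: v) hu (.birth b)
  have w2 := writhe_cross_succ c w b (!b) x v hu
  have w3 := writhe_cons (j := j + 1) (u := u ++ [x]) (⟨j, .cross (!c)⟩ :: w) v (by simp [hu])
    (.birth b)
  have w4 := writhe_cross (!c) w x b ((!b) :: v) hu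
  simp only [List.append_assoc, List.cons_append, List.nil_append] at w1 w3
  rw [w1, w2, w3, w4, show crossingSign c (!b) x = crossingSign (!c) x b by
    cases c <;> cases b <;> cases x <;> rfl]
  congr 1
  simp only [List.length_append, List.length_cons] at hl
  have l1 := State.hook_length (j + 1) (s.birth j) (by rw [State.birth_length]; omega)
  rw [State.birth_length] at l1
  have z := State.Same.birth (s.zigzag_right j (by omega)) (j + 1)
  have r := stateSum_congr (fun n => loopValue ^ n) w _ _ _ hw (by
    rw [State.birth_length]; simp only [List.length_append, List.length_cons]; omega) z
  simp only [rawSum, stateSum, (coeff_not c).1, (coeff_not c).2]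
  rw [State.hook, ← r, State.hook, s.zigzag_left j (by omega), add_comm]

theorem agree_slide_death (j : ℕ) (c : Bool) (w : List Slice) :
    Agree (⟨j + 1, .cross c⟩ :: ⟨j, .death⟩ :: w)
      (⟨j, .cross (!c)⟩ :: ⟨j + 1, .death⟩ :: w) := by
  intro o s hl hx hy
  have hlen : j + 1 + 2 ≤ o.length := closes_length hx
  obtain ⟨u, x, y, z, v, rfl, hu⟩ := three_split o j (by omega)
  have hx' := closes_cross_succ hu hx
  have hw : x = (!z) ∧ Closes w (u ++ y :: v) := by
    subst hu
    have := hx'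
    simp only [Closes, List.drop_left, List.take_left] at this
    exact ⟨by rw [this.1, Bool.not_not], this.2⟩
  obtain ⟨rfl, hw⟩ := hw
  have w1 := writhe_cross_succ c (⟨j, .death⟩ :: w) (!z) y z v hu
  have w2 := writhe_cons (j := j) w (y :: v) hu (.death (!z))
  have w3 := writhe_cross (!c) (⟨j + 1, .death⟩ :: w) (!z) y (z :: v) hu
  have w4 := writhe_cons (j := j + 1) (u := u ++ [y]) w v (by simp [hu]) (.death (!z))
  simp only [List.append_assoc, List.cons_append, List.nil_append, Bool.not_not] at w2 w4
  rw [w1, w3, w4, show crossingSign c y z = crossingSign (!c) (!z) y by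
    cases c <;> cases y <;> cases z <;> rfl]
  have hxz : writhe (⟨j, .death⟩ :: w) (u ++ (!z) :: z :: y :: v) = 0 + writhe w (u ++ y :: v) := w2
  rw [hxz]
  congr 1
  simp only [List.length_append, List.length_cons] at hl
  have d1 := s.death_length (j + 1) (by omega)
  have d2 := s.death_length j (by omega)
  have e1 := State.zigzag_right j (s.death j) (by omega)
  have r := stateSum_congr (fun n => loopValue ^ n) w _ _ _ hw (by
    simp only [List.length_append, List.length_cons]; omega) e1
  simp only [rawSum, stateSum, (coeff_not c).1, (coeff_not c).2, State.hook]
  rw [State.zigzag_left j _ (by omega), ← r, add_comm]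

theorem agree_one_birth (j : ℕ) (b c : Bool) (w : List Slice) :
    Agree (⟨j, .birth b⟩ :: ⟨j, .cross c⟩ :: w) (⟨j, .birth (!b)⟩ :: w) := by
  intro o s hl hx hy
  have hlen : j ≤ o.length := closes_length hx
  obtain ⟨u, v, rfl, hu⟩ := exists_split o j (by omega)
  have w1 := writhe_cons (j := j) (⟨j, .cross c⟩ :: w) v hu (.birth b)
  have w2 := writhe_cross c w b (!b) v hu
  have w3 := writhe_cons (j := j) w v hu (.birth (!b))
  simp only [List.cons_append, List.nil_append, Bool.not_not] at w1 w3
  rw [w1, w2, w3, show crossingSign c b (!b) = if c then -1 else 1 by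
    cases c <;> cases b <;> rfl, zero_add, zero_add, writheFactor_add]
  simp only [rawSum, stateSum]
  rw [State.hook, State.death_birth j s (by omega)]
  have hL := stateSum_loop w s.loops
    (s.labels.take j ++ freshLabel s.labels :: freshLabel s.labels :: s.labels.drop j)
  simp only [State.birth]
  rw [hL, loopValue_eq c]
  have h2 := coeff_mul c
  have h3 := writheFactor_kink c
  generalize powA (if c = true then 1 else -1) = A at *
  generalize powA (if c = true then -1 else 1) = B at *
  generalize writheFactor (if c = true then -1 else 1) = K at *
  generalize stateSum _ w _ = X
  linear_combination writheFactor (writhe w (u ++ (!b) :: b :: v)) * X * (h3 - K * A * h2)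

theorem agree_one_death (j : ℕ) (c : Bool) (w : List Slice) :
    Agree (⟨j, .cross c⟩ :: ⟨j, .death⟩ :: w) (⟨j, .death⟩ :: w) := by
  intro o s hl hx hy
  have hlen : j + 2 ≤ o.length := closes_length hx
  obtain ⟨u, x, y, v, rfl, hu⟩ := exists_split_two o j hlen
  obtain rfl : y = !x := by
    subst hu
    simp only [Closes, List.drop_left, List.take_left] at hy
    exact hy.1
  have w1 := writhe_cross c (⟨j, .death⟩ :: w) x (!x) v hu
  have w2 := writhe_cons (j := j) w v hu (.death x)
  have w3 := writhe_cons (j := j) w v hu (.death (!x))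
  simp only [List.cons_append, List.nil_append, Bool.not_not] at w2 w3
  rw [w1, w2, w3, show crossingSign c x (!x) = if c then -1 else 1 by
    cases c <;> cases x <;> rfl, zero_add, writheFactor_add]
  have d1 := s.death_length j (by omega)
  have key : powA (if c then 1 else -1) * rawSum w (s.death j) +
      powA (if c then -1 else 1) * rawSum w ((s.hook j).death j) =
      -powA (if c then -1 else 1) ^ 3 * rawSum w (s.death j) := by
    have hL : rawSum w ⟨(s.death j).loops + 1, (s.death j).labels⟩ =
        loopValue * rawSum w (s.death j) := stateSum_loop w _ _
    rw [State.hook, State.death_birth j _ (by omega), hL, loopValue_eq c]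
    linear_combination -powA (if c then 1 else -1) * rawSum w (s.death j) * coeff_mul c
  have h3 := writheFactor_kink c
  simp only [rawSum, stateSum] at key ⊢
  rw [key]
  linear_combination writheFactor (writhe w (u ++ v)) *
    stateSum (fun n => loopValue ^ n) w (s.death j) * h3

theorem LocalMove.agree {r r' : List Slice} (h : LocalMove r r') (w : List Slice) :
    Agree (r ++ w) (r' ++ w) := by
  cases h with
  | exchange p q i k => exact agree_exchange p q i k w
  | zigzag_right j b => exact agree_zigzag_right j b w
  | zigzag_left j b => exact agree_zigzag_left j b w
  | slide_birth j b c => exact agree_slide_birth j b c w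
  | slide_death j c => exact agree_slide_death j c w
  | reidemeister_one_birth j b c => exact agree_one_birth j b c w
  | reidemeister_one_death j c => exact agree_one_death j c w
  | reidemeister_two j c => exact agree_two j c w
  | reidemeister_three j c => exact agree_three j c w

theorem count_merge {a b : ℕ} (h : a ≠ b) (y : ℕ) (l : List ℕ) :
    (l.map fun x => if x = b then a else x).count y =
      if y = a then l.count a + l.count b else if y = b then 0 else l.count y := by
  induction l with
  | nil => simp
  | cons x l ih =>
    simp only [List.map_cons, List.count_cons, ih, beq_iff_eq]
    split_ifs <;> grind

theorem even_birth (j : ℕ) (s : State) (h : ∀ x, Even (s.labels.count x)) (x : ℕ) :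
    Even ((s.birth j).labels.count x) := by
  have h0 := h x
  rw [← List.take_append_drop j s.labels, List.count_append] at h0
  simp only [State.birth, List.count_append, List.count_cons]
  split_ifs
  · obtain ⟨m, hm⟩ := h0
    exact ⟨m + 1, by omega⟩
  · simpa using h0

theorem even_death (j : ℕ) (s : State) (hj : j + 2 ≤ s.labels.length)
    (h : ∀ x, Even (s.labels.count x)) :
    (∀ x, Even ((s.death j).labels.count x)) ∧
      (0 < (s.death j).loops ∨ (s.death j).labels ≠ []) := by
  obtain ⟨n, l⟩ := s
  obtain ⟨u, a, b, v, rfl, hu⟩ := exists_split_two l j hj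
  rw [State.death_eq hu]
  have hc : ∀ x, (u ++ a :: b :: v).count x = (u ++ v).count x + (if a = x then 1 else 0) +
      if b = x then 1 else 0 := by
    intro x
    simp only [List.count_append, List.count_cons, beq_iff_eq]
    omega
  simp only [hc] at h
  split_ifs with hab
  · subst hab
    refine ⟨fun x => ?_, .inl (by simp)⟩
    obtain ⟨m, hm⟩ := h x
    simp only
    split_ifs at hm
    · exact ⟨m - 1, by omega⟩
    · exact ⟨m, by omega⟩
  · have ha := h a
    have hb := h b
    simp only [if_true, if_neg hab, if_neg (Ne.symm hab), add_zero] at ha hb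
    refine ⟨fun x => ?_, .inr ?_⟩
    · simp only [count_merge hab]
      split_ifs with h1 h2
      · obtain ⟨m, hm⟩ := ha
        obtain ⟨m', hm'⟩ := hb
        exact ⟨m + m' - 1, by omega⟩
      · exact Even.zero
      · have := h x
        rwa [if_neg (Ne.symm h1), if_neg (Ne.symm h2)] at this
    · intro h0
      simp only [List.map_eq_nil_iff] at h0
      rw [h0] at ha
      simp at ha

theorem rawSum_eq_loopValue_mul (w : List Slice) : ∀ (o : List Bool) (s : State), Closes w o →
    s.labels.length = o.length → (∀ x, Even (s.labels.count x)) →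
    (0 < s.loops ∨ s.labels ≠ [] ∨ w ≠ []) →
    rawSum w s = loopValue * stateSum (fun n => loopValue ^ (n - 1)) w s := by
  induction w with
  | nil =>
    intro o s hc hl _ h
    simp only [Closes] at hc
    subst hc
    have : s.labels = [] := List.length_eq_zero_iff.1 hl
    have hn : 0 < s.loops := by simpa [this] using h
    simp only [rawSum, stateSum]
    rw [← pow_succ', Nat.sub_add_cancel hn]
  | cons x w ih =>
    obtain ⟨j, p⟩ := x
    intro o s hc hl he _
    have hlen := closes_length hc
    obtain ⟨u, P, Q, v, σ, rfl, hu, hP, hw⟩ := closes_cons hc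
    have h1 := hP.src
    have h2 := hP.tgt
    simp only [List.length_append] at hl hlen
    have hb : ∀ t : State, (t.birth j).labels ≠ [] := fun t ht => by
      have := t.birth_length j
      simp [ht] at this
    cases p with
    | birth b =>
      simp only [Piece.src, Piece.tgt] at h1 h2
      exact ih _ _ hw (by rw [State.birth_length]; simp; omega) (even_birth j s he)
        (.inr (.inl (hb s)))
    | death =>
      simp only [Piece.src, Piece.tgt] at h1 h2 hlen
      have := s.death_length j (by omega)
      have ev := even_death j s (by omega) he
      exact ih _ _ hw (by simp; omega) ev.1 (by tauto)
    | cross c =>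
      simp only [Piece.src, Piece.tgt] at h1 h2 hlen
      have := s.hook_length j (by omega)
      have ev := even_death j s (by omega) he
      have i1 := ih _ s hw (by simp; omega) he
        (.inr (.inl (fun h0 => by simp [h0] at hl; omega)))
      have i2 := ih _ (s.hook j) hw (by simp; omega) (even_birth j _ ev.1) (.inr (.inl (hb _)))
      simp only [rawSum, stateSum] at i1 i2 ⊢
      rw [i1, i2]
      ring

theorem loopValue_ne_zero : loopValue ≠ 0 := by
  intro h
  have := congrArg (LaurentPolynomial.eval₂ (RingHom.id ℤ) (1 : ℤˣ)) h
  simp [loopValue, powA] at this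

theorem Move.jones_eq {D E : Diagram} (h : Move D E) : D.jones = E.jones := by
  obtain ⟨u, r, r', v, hr, hD, hE⟩ := h
  have key := ((hr.agree v).append u) [] ⟨0, []⟩ rfl
    (by rw [← List.append_assoc, ← hD]; exact D.closes)
    (by rw [← List.append_assoc, ← hE]; exact E.closes)
  rw [← List.append_assoc, ← hD, ← List.append_assoc, ← hE,
    rawSum_eq_loopValue_mul _ _ _ D.closes rfl (by simp) (.inr (.inr D.nonempty)),
    rawSum_eq_loopValue_mul _ _ _ E.closes rfl (by simp) (.inr (.inr E.nonempty))] at key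
  apply mul_left_cancel₀ loopValue_ne_zero
  simp only [Diagram.jones, Diagram.bracket]
  linear_combination key

/-- Isotopy classes of nonempty oriented links in space: diagrams modulo planar isotopy and
the Reidemeister moves. -/
def Link : Type := Quot Move

/-- The link with the given diagram. -/
def Diagram.toLink (D : Diagram) : Link := Quot.mk Move D

/-- The Jones polynomial of an oriented link. -/
noncomputable def Link.jones : Link → ℤ[T;T⁻¹] :=
  Quot.lift Diagram.jones fun _ _ h => h.jones_eq

/-! ### Pretzel knots -/

/-- A vertical tassel of `|n|` crossings between the strands `j` and `j + 1`; for `n > 0` the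
over-strand has the shape `/`, for `n < 0` the shape `\`. -/
def tassel (j : ℕ) (n : ℤ) : List Slice :=
  List.replicate n.natAbs ⟨j, .cross (decide (0 < n))⟩

/-- The standard diagram of the pretzel link `P(p, q, r)`: three vertical tassels side by side,
where each one is joined to the next one, and the last one to the first one, by an arc at the
top and an arc at the bottom. The orientation, in which the two strands of a tassel run in
opposite directions, is one of the two orientations of `P(p, q, r)` for odd `p`, `q`, `r`;
it is chosen by `b`. So the crossings of a tassel with positive parameter are negative crossings,
and those of a tassel with negative parameter are positive ones. -/
def pretzelWord (b : Bool) (p q r : ℤ) : List Slice :=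
  [⟨0, .birth b⟩, ⟨1, .birth (!b)⟩, ⟨3, .birth (!b)⟩] ++
    (tassel 0 p ++ (tassel 2 q ++ (tassel 4 r ++ [⟨1, .death⟩, ⟨1, .death⟩, ⟨0, .death⟩])))

theorem closes_tassel (w : List Slice) {j : ℕ} {n : ℤ} (hn : Odd n) {u : List Bool}
    (hu : u.length = j) (a b : Bool) (v : List Bool) (h : Closes w (u ++ b :: a :: v)) :
    Closes (tassel j n ++ w) (u ++ a :: b :: v) := by
  subst hu
  obtain ⟨m, hm⟩ := Int.natAbs_odd.2 hn
  rw [tassel, hm]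
  clear hm
  generalize decide (0 < n) = c
  have step : ∀ (x y : Bool) (w' : List Slice), Closes w' (u ++ y :: x :: v) →
      Closes (⟨u.length, .cross c⟩ :: w') (u ++ x :: y :: v) := by
    intro x y w' h'
    simpa [Closes] using h'
  induction m with
  | zero => simpa [Closes] using h
  | succ m ih =>
    have : 2 * (m + 1) + 1 = (2 * m + 1) + 1 + 1 := by ring
    rw [this, List.replicate_succ, List.replicate_succ]
    exact step a b _ (step b a _ ih)

/-- The standard oriented diagram of the pretzel knot `P(p, q, r)` for odd `p`, `q`, `r`. -/
def pretzelDiagram (b : Bool) (p q r : ℤ) (hp : Odd p) (hq : Odd q) (hr : Odd r) : Diagram where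
  word := pretzelWord b p q r
  nonempty := by simp [pretzelWord]
  closes := by
    have h4 := closes_tassel [⟨1, .death⟩, ⟨1, .death⟩, ⟨0, .death⟩] (j := 4) hr
      (u := [!b, b, !b, b]) rfl b (!b) [] (by simp [Closes])
    have h2 := closes_tassel _ (j := 2) hq (u := [!b, b]) rfl b (!b) [b, !b] h4
    have h0 := closes_tassel _ (j := 0) hp (u := []) rfl b (!b) [b, !b, b, !b] h2
    simpa [pretzelWord, Closes] using h0

/-- The oriented pretzel knot `P(p, q, r)` for odd `p`, `q`, `r`. -/
def pretzelKnot (b : Bool) (p q r : ℤ) (hp : Odd p) (hq : Odd q) (hr : Odd r) : Link :=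
  (pretzelDiagram b p q r hp hq hr).toLink

end KnotTheory

open LaurentPolynomial

namespace KnotTheory

/-! Write a = A, a' = A⁻¹ and d = -a² - a'² for the value of a loop. A crossing with over-strand `/`
acts on the bracket as a·I + a'·H, where I is the pair of vertical strands and H the hook, with H² =
d·H. Hence H is an eigenvector of the crossing, with eigenvalue a + a'd = -a'³, and n crossings in a
row give aⁿ·I + (((-a'³)ⁿ - aⁿ)/d)·H. This is `loopValue_mul_rawSum_replicate_cross`, with d cleared
from the denominator.

Let r > 0 be the odd parameter of the third tassel, all of whose crossings have over-strand `/`.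
Expanding the first two tassels of P(-3,3,r) as well leaves eight diagrams without crossings, and
counting their loops gives the state sum (`loopValue_mul_rawSum_pretzelWord_three`). The strands of
every tassel are antiparallel, so the writhe is -(-3) - 3 - r = -r for both orientations
(`writhe_pretzelWord`). The writhe factor (-a³)^r turns a^r into -t^(-r) and (-a'³)^r into 1, so r
enters the answer only through t^(-r).

The shape of the result has a geometric reason. With the third tassel replaced by H, the tassels -3
and 3 cancel by second Reidemeister moves and leave a two-component unlink, of state sum d². With
the third tassel replaced by I, the diagram is the closed 3-braid of a left and a right trefoil
joined along a strand, the square knot S, of writhe 0 and state sum d·V(S). Therefore V(P(-3,3,r)) =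
1 + t^(-r)·(1 - V(S)), where V(S) = (t + t³ - t⁴)(t⁻¹ + t⁻³ - t⁻⁴). The proof does not name these
links: it checks the corresponding polynomial identity from a·a' = 1 in
`jones_pretzelDiagram_three`. -/

/-! ### State sum of a row of crossings -/

/-- The crossing is diagonalised: `s.hook j` is an eigenvector, and the bare crossing differs from
the scalar a by a multiple of the hook. The factor `loopValue` on both sides replaces division by
it. The induction runs over all states, because the top crossing leads to both `s` and `s.hook j`.
-/
theorem loopValue_mul_rawSum_replicate_cross (c : Bool) (j n : ℕ) (w : List Slice) (s : State)
    (h : j + 2 ≤ s.labels.length) :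
    loopValue * rawSum (List.replicate n ⟨j, .cross c⟩ ++ w) s =
      powA (if c then 1 else -1) ^ n * (loopValue * rawSum w s) +
        ((-powA (if c then -1 else 1) ^ 3) ^ n - powA (if c then 1 else -1) ^ n) *
          rawSum w (s.hook j) := by
  induction n generalizing s with
  | zero => simp
  | succ n ih =>
    have h1 := ih s h
    have h2 := ih (s.hook j) (by rw [State.hook_length j s h]; exact h)
    rw [rawSum_hook_hook w j s h] at h2
    have hs : rawSum (List.replicate (n + 1) ⟨j, .cross c⟩ ++ w) s =
        powA (if c then 1 else -1) * rawSum (List.replicate n ⟨j, .cross c⟩ ++ w) s +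
          powA (if c then -1 else 1) *
            rawSum (List.replicate n ⟨j, .cross c⟩ ++ w) (s.hook j) := by
      simp only [rawSum, List.replicate_succ, List.cons_append, stateSum]
    have hc := coeff_mul c
    have hd := loopValue_eq c
    rw [hs]
    generalize powA (if c then 1 else -1) = a at *
    generalize powA (if c then -1 else 1) = a' at *
    generalize rawSum w (s.hook j) = R at *
    -- The eigenvalue relation a + a'd = -a'³.
    have hk : a' * loopValue = -a - a' ^ 3 := by rw [hd]; linear_combination (-a) * hc
    linear_combination a * h1 + a' * h2 + (-a' ^ 3) ^ n * R * hk

/-! ### Writhe of the pretzel diagram -/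

/-- A crossing of antiparallel strands has a sign depending only on `c`, and below it the strands
are again antiparallel, in the opposite order. Oddness of `n` makes the two orientations arrive
exchanged, so the induction adds two crossings at a time. -/
theorem writhe_replicate_cross (c : Bool) (j n : ℕ) (w : List Slice) {u : List Bool}
    (hu : u.length = j) (x : Bool) (v : List Bool) (hn : Odd n) :
    writhe (List.replicate n ⟨j, .cross c⟩ ++ w) (u ++ x :: (!x) :: v) =
      (if c then -(n : ℤ) else n) + writhe w (u ++ (!x) :: x :: v) := by
  obtain ⟨m, rfl⟩ := hn
  have hsign : ∀ y, crossingSign c y (!y) = if c then -1 else 1 := by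
    intro y; cases c <;> cases y <;> rfl
  have hstep : ∀ (y : Bool) (w' : List Slice),
      writhe (⟨j, .cross c⟩ :: w') (u ++ y :: (!y) :: v) =
        (if c then -1 else 1) + writhe w' (u ++ (!y) :: y :: v) := by
    intro y w'
    rw [writhe_cross c w' y (!y) v hu, hsign]
  induction m with
  | zero => simpa using hstep x w
  | succ m ih =>
    have h2 := hstep (!x) (List.replicate (2 * m + 1) ⟨j, .cross c⟩ ++ w)
    rw [Bool.not_not] at h2
    rw [show 2 * (m + 1) + 1 = (2 * m + 1) + 1 + 1 by ring, List.replicate_succ,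
      List.replicate_succ, List.cons_append, List.cons_append, hstep, h2, ih]
    cases c <;> simp <;> ring

/-- The over-strand of a tassel follows the sign of `n`, so the signs add up to -|n| for positive
`n` and to |n| otherwise: -n in both cases. -/
theorem writhe_tassel {j : ℕ} {n : ℤ} (w : List Slice) {u : List Bool}
    (hu : u.length = j) (x : Bool) (v : List Bool) (hn : Odd n) :
    writhe (tassel j n ++ w) (u ++ x :: (!x) :: v) = -n + writhe w (u ++ (!x) :: x :: v) := by
  rw [tassel, writhe_replicate_cross _ _ _ _ hu _ _ (Int.natAbs_odd.2 hn)]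
  congr 1
  by_cases h : 0 < n
  · simp [h, abs_of_pos h]
  · simp [h, abs_of_nonpos (not_lt.1 h)]

/-- All three tassels start with orientations `b, !b` and contribute minus their parameters. The
value is free of `b`, which is why both orientations of the knot have the same polynomial. -/
theorem writhe_pretzelWord (b : Bool) {p q r : ℤ} (hp : Odd p) (hq : Odd q) (hr : Odd r) :
    writhe (pretzelWord b p q r) [] = -p - q - r := by
  have h4 := writhe_tassel (j := 4) [⟨1, .death⟩, ⟨1, .death⟩, ⟨0, .death⟩]
    (u := [!b, b, !b, b]) rfl b [] hr
  have h2 := fun w => writhe_tassel (j := 2) w (u := [!b, b]) rfl b [b, !b] hq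
  have h0 := fun w => writhe_tassel (j := 0) w (u := []) rfl b [b, !b, b, !b] hp
  simp only [List.nil_append, List.cons_append] at h0 h2 h4
  simp only [pretzelWord, List.cons_append, List.nil_append, writhe, List.take_zero,
    List.drop_zero, List.take_succ_cons, List.drop_succ_cons, Bool.not_not, List.take_nil, List.drop_nil]
  rw [h0, h2, h4]
  simp [writhe]
  ring

/-! ### State sum of P(-3, 3, n + 1) -/

/-- For three crossings the division by d can be carried out: given a·a' = 1, one has -a'⁹ - a³ =
d·(a - a'³ + a'⁷). -/
theorem rawSum_replicate_cross_three (c : Bool) (j : ℕ) (w : List Slice) (s : State)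
    (h : j + 2 ≤ s.labels.length) :
    rawSum (List.replicate 3 ⟨j, .cross c⟩ ++ w) s =
      powA (if c then 1 else -1) ^ 3 * rawSum w s +
        (powA (if c then 1 else -1) - powA (if c then -1 else 1) ^ 3 +
          powA (if c then -1 else 1) ^ 7) * rawSum w (s.hook j) := by
  apply mul_left_cancel₀ loopValue_ne_zero
  rw [loopValue_mul_rawSum_replicate_cross c j 3 w s h, loopValue_eq c]
  have hc := coeff_mul c
  grind

/-- The three local minima of the standard pretzel diagram. -/
def pretzelMinima : List Slice := [⟨1, .death⟩, ⟨1, .death⟩, ⟨0, .death⟩]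

/-- The strands below the three local maxima of the standard pretzel diagram. -/
def pretzelMaxima : State := ⟨0, [1, 2, 2, 3, 3, 1]⟩

/-- The state sum ignores orientations, so `b` drops out; `freshLabel` produces exactly the labels
of `pretzelMaxima`. -/
theorem rawSum_pretzelWord (b : Bool) (p q r : ℤ) :
    rawSum (pretzelWord b p q r) ⟨0, []⟩ =
      rawSum (tassel 0 p ++ (tassel 2 q ++ (tassel 4 r ++ pretzelMinima))) pretzelMaxima :=
  rfl

/-- `f` is the hook coefficient of the tassel 3, `f'` that of the tassel -3. The two bracketed sums
of four terms are the state sums in which the last tassel is replaced by two vertical strands and by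
a hook, respectively. That tassel alone has variable length, whence the single factor `d` on the
left. -/
theorem loopValue_mul_rawSum_pretzelWord_three (b : Bool) (n : ℕ) :
    let a := powA 1
    let a' := powA (-1)
    let f := a - a' ^ 3 + a' ^ 7
    let f' := a' - a ^ 3 + a ^ 7
    let d := loopValue
    d * rawSum (pretzelWord b (-3) 3 ((n + 1 : ℕ) : ℤ)) ⟨0, []⟩ =
      a ^ (n + 1) * (d * (a ^ 3 * a' ^ 3 * d ^ 3 + f * a' ^ 3 * d ^ 2 + f' * a ^ 3 * d ^ 2 +
        f * f' * d)) +
      ((-a' ^ 3) ^ (n + 1) - a ^ (n + 1)) * (a ^ 3 * a' ^ 3 * d ^ 2 + f * a' ^ 3 * d +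
        f' * a ^ 3 * d + f * f' * d ^ 2) := by
  intro a a' f f' d
  have h0 := fun w s => rawSum_replicate_cross_three false 0 w s
  have h2 := fun w s => rawSum_replicate_cross_three true 2 w s
  have h4 := fun s => loopValue_mul_rawSum_replicate_cross true 4 (n + 1) pretzelMinima s
  have t0 : tassel 0 (-3) = List.replicate 3 ⟨0, .cross false⟩ := rfl
  have t2 : tassel 2 3 = List.replicate 3 ⟨2, .cross true⟩ := rfl
  -- The form n + 1 makes the parameter positive, which fixes the over-strand as `/`.
  have t4 : tassel 4 ((n + 1 : ℕ) : ℤ) = List.replicate (n + 1) ⟨4, .cross true⟩ := by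
    rw [tassel, decide_eq_true (by positivity), Int.natAbs_natCast]
  -- Without hooks there are three circles, and each tassel joins two of them. The first hook merges
  -- two circles, the second leaves a single one, and the third cuts it into an upper and a lower
  -- circle. So 0, 1, 2, 3 hooks give 3, 2, 1, 2 loops.
  have e00 : rawSum pretzelMinima pretzelMaxima = d ^ 3 := rfl
  have e10 : rawSum pretzelMinima (pretzelMaxima.hook 0) = d ^ 2 := rfl
  have e01 : rawSum pretzelMinima (pretzelMaxima.hook 2) = d ^ 2 := rfl
  have e11 : rawSum pretzelMinima ((pretzelMaxima.hook 0).hook 2) = d ^ 1 := rfl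
  have e001 : rawSum pretzelMinima (pretzelMaxima.hook 4) = d ^ 2 := rfl
  have e101 : rawSum pretzelMinima ((pretzelMaxima.hook 0).hook 4) = d ^ 1 := rfl
  have e011 : rawSum pretzelMinima ((pretzelMaxima.hook 2).hook 4) = d ^ 1 := rfl
  have e111 : rawSum pretzelMinima (((pretzelMaxima.hook 0).hook 2).hook 4) = d ^ 2 := rfl
  have l00 := h4 pretzelMaxima (by decide)
  have l10 := h4 (pretzelMaxima.hook 0) (by decide)
  have l01 := h4 (pretzelMaxima.hook 2) (by decide)
  have l11 := h4 ((pretzelMaxima.hook 0).hook 2) (by decide)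
  rw [rawSum_pretzelWord, t0, t2, t4, h0 _ _ (by decide), h2 _ _ (by decide),
    h2 _ _ (by decide)]
  simp only [if_true, Bool.false_eq_true, if_false] at *
  rw [e00, e001] at l00
  rw [e10, e101] at l10
  rw [e01, e011] at l01
  rw [e11, e111] at l11
  linear_combination a' ^ 3 * a ^ 3 * l00 + f' * a ^ 3 * l10 + a' ^ 3 * f * l01 + f' * f * l11

/-! ### Effect of the writhe factor, and powers of t -/

theorem powA_nat (n : ℕ) : powA n = powA 1 ^ n := by
  simp [powA, T_pow]

/-- Writhe -n contributes (-a³)ⁿ, so the product is (-1)ⁿa⁴ⁿ, with t = a⁻⁴ and `n` odd. -/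
theorem writheFactor_mul_powA_pow {n : ℕ} (hn : Odd n) :
    writheFactor (-n) * powA 1 ^ n = -powt (-n) := by
  rw [writheFactor, Int.negOnePow_odd _ ((Int.odd_coe_nat n).2 hn).neg, ← powA_nat]
  simp only [Units.val_neg, Units.val_one, neg_smul, one_smul, neg_mul, ← powA_add]
  simp only [powA, powt]
  congr 2
  ring

/-- The eigenvalue -a'³ of the hook is the factor of a first Reidemeister kink, which the writhe
normalisation removes one crossing at a time. -/
theorem writheFactor_mul_neg_powA_pow (n : ℕ) :
    writheFactor (-n) * (-powA (-1) ^ 3) ^ n = 1 := by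
  induction n with
  | zero => simp [writheFactor_zero]
  | succ n ih =>
    have h := writheFactor_kink true
    simp only [if_true] at h
    rw [Nat.cast_succ, neg_add, writheFactor_add, pow_succ]
    linear_combination h + writheFactor (-1) * -powA (-1) ^ 3 * ih

theorem powt_add (m n : ℤ) : powt (m + n) = powt m * powt n := by
  simp only [powt, ← T_add]; congr 1; ring

/-- With natural exponents on both a and a⁻¹, the final identity becomes one between ordinary
polynomials modulo a·a' = 1. -/
theorem powt_natCast (n : ℕ) : powt n = powA (-1) ^ (4 * n) := by
  simp only [powt, powA, T_pow]; congr 1; push_cast; ring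

theorem powt_neg_natCast (n : ℕ) : powt (-n) = powA 1 ^ (4 * n) := by
  simp only [powt, powA, T_pow]; congr 1; push_cast; ring

/-! ### The Jones polynomial of P(-3, 3, n + 1) -/

/-- The polynomial in the parentheses is 1 - V(S) for the square knot S; the final 1 comes from the
hooked third tassel, an unlink of state sum d². -/
theorem jones_pretzelDiagram_three (b : Bool) (n : ℕ) (hp : Odd (-3 : ℤ)) (hq : Odd (3 : ℤ))
    (hr : Odd ((n + 1 : ℕ) : ℤ)) :
    (pretzelDiagram b (-3) 3 ((n + 1 : ℕ) : ℤ) hp hq hr).jones =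
      powt (-(n + 1 : ℕ)) * (powt (-3) - powt (-2) + powt (-1) - 2 + powt 1 - powt 2 + powt 3)
        + 1 := by
  set D := pretzelDiagram b (-3) 3 ((n + 1 : ℕ) : ℤ) hp hq hr with hD
  have hraw := rawSum_eq_loopValue_mul D.word [] ⟨0, []⟩ D.closes rfl (by simp)
    (.inr (.inr D.nonempty))
  have hval := loopValue_mul_rawSum_pretzelWord_three b n
  have hn := (Int.odd_coe_nat _).1 hr
  have w1 := writheFactor_mul_powA_pow hn
  have w2 := writheFactor_mul_neg_powA_pow (n + 1)
  have hw : writhe D.word [] = -((n + 1 : ℕ) : ℤ) := by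
    rw [hD, pretzelDiagram, writhe_pretzelWord b hp hq hr]; ring
  have t3 := powt_natCast 3
  have t2 := powt_natCast 2
  have t1 := powt_natCast 1
  have u3 := powt_neg_natCast 3
  have u2 := powt_neg_natCast 2
  have u1 := powt_neg_natCast 1
  have hc := coeff_mul true
  have hd := loopValue_eq true
  have hd0 := loopValue_ne_zero
  change rawSum (pretzelWord b (-3) 3 ((n + 1 : ℕ) : ℤ)) ⟨0, []⟩ = loopValue * D.bracket at hraw
  simp only [if_true, Nat.cast_ofNat, Nat.cast_one] at *
  rw [Diagram.jones, hw, t3, t2, t1, u3, u2, u1]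
  rw [hraw] at hval
  -- From here on `n` is hidden: `w1`, `w2` and `hval` are all that is needed about the powers
  -- depending on it.
  generalize powt (-((n + 1 : ℕ) : ℤ)) = P at *
  generalize writheFactor (-((n + 1 : ℕ) : ℤ)) = W at *
  generalize D.bracket = J at *
  generalize powA 1 ^ (n + 1) = y at *
  generalize (-powA (-1) ^ 3) ^ (n + 1) = z at *
  generalize powA 1 = a at *
  generalize powA (-1) = a' at *
  -- One factor d normalises the bracket of the unknot to 1; the other is the denominator cleared in
  -- the tassel formula.
  apply mul_left_cancel₀ hd0
  apply mul_left_cancel₀ hd0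
  -- `R₀` and `R₁` belong to the vertical and the hooked third tassel. They stay opaque while the
  -- writhe factor is absorbed. As polynomials modulo a·a' = 1 they equal d²·V(S) and d².
  obtain ⟨R₀, hR₀⟩ : ∃ R₀, R₀ = loopValue * (a ^ 3 * a' ^ 3 * loopValue ^ 3 +
        (a - a' ^ 3 + a' ^ 7) * a' ^ 3 * loopValue ^ 2 +
        (a' - a ^ 3 + a ^ 7) * a ^ 3 * loopValue ^ 2 +
        (a - a' ^ 3 + a' ^ 7) * (a' - a ^ 3 + a ^ 7) * loopValue) := ⟨_, rfl⟩
  obtain ⟨R₁, hR₁⟩ : ∃ R₁, R₁ =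
      (a ^ 3 * a' ^ 3 * loopValue ^ 2 +
        (a - a' ^ 3 + a' ^ 7) * a' ^ 3 * loopValue +
        (a' - a ^ 3 + a ^ 7) * a ^ 3 * loopValue +
        (a - a' ^ 3 + a' ^ 7) * (a' - a ^ 3 + a ^ 7) * loopValue ^ 2) := ⟨_, rfl⟩
  rw [← hR₀, ← hR₁] at hval
  have hP : loopValue * (loopValue * (W * J)) = -P * R₀ + (1 + P) * R₁ := by
    linear_combination W * hval + (R₀ - R₁) * w1 + R₁ * w2
  rw [hP, hR₀, hR₁, hd]
  -- What remains is an identity in a, a' and a free `P`, using only a·a' = 1.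
  clear * - hc
  grind
end KnotTheory

theorem theorem3p1 (i : ℤ) (hi : 2 < i) (b : Bool) :
    (KnotTheory.pretzelKnot b (-3) 3 (2 * i + 1) (by decide) (by decide)
        (odd_two_mul_add_one i)).jones =
      KnotTheory.powt (-2 * i - 4) - KnotTheory.powt (-2 * i - 3) + KnotTheory.powt (-2 * i - 2)
        - 2 * KnotTheory.powt (-2 * i - 1) + KnotTheory.powt (-2 * i)
        - KnotTheory.powt (-2 * i + 1) + KnotTheory.powt (-2 * i + 2) + 1 := by
  -- The parameter is made a variable so that n + 1 can be substituted for it, also inside the type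
  -- of the oddness proof.
  have h : ∀ (r : ℤ) (hr : Odd r), 0 < r →
      (KnotTheory.pretzelKnot b (-3) 3 r (by decide) (by decide) hr).jones =
        KnotTheory.powt (-r) * (KnotTheory.powt (-3) - KnotTheory.powt (-2) +
          KnotTheory.powt (-1) - 2 + KnotTheory.powt 1 - KnotTheory.powt 2 +
          KnotTheory.powt 3) + 1 := by
    intro r hr hpos
    obtain ⟨n, rfl⟩ : ∃ n : ℕ, r = ((n + 1 : ℕ) : ℤ) := ⟨(r - 1).toNat, by omega⟩
    exact KnotTheory.jones_pretzelDiagram_three b n (by decide) (by decide) hr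
  rw [h _ _ (by omega)]
  have e : ∀ k m : ℤ, -(2 * i + 1) + k = m →
      KnotTheory.powt (-(2 * i + 1)) * KnotTheory.powt k = KnotTheory.powt m := by
    rintro k m rfl
    rw [KnotTheory.powt_add]
  -- The constant term -2 of the parentheses has no factor `powt k`, so its exponent is rewritten
  -- separately.
  have e0 : KnotTheory.powt (-(2 * i + 1)) = KnotTheory.powt (-2 * i - 1) :=
    congrArg KnotTheory.powt (by ring)
  linear_combination e (-3) (-2 * i - 4) (by ring) - e (-2) (-2 * i - 3) (by ring) +
    e (-1) (-2 * i - 2) (by ring) - 2 * e0 + e 1 (-2 * i) (by ring) -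
    e 2 (-2 * i + 1) (by ring) + e 3 (-2 * i + 2) (by ring)
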